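/- Let $\mu,\nu$ be Borel probability measures on $\mathbb{R}$ with finite second moments, let $\lambda$ be Lebesgue measure, let $C$ be the convex hull of $\operatorname{supp}\nu$ and $I$ its interior. Assume (A'): $\mu\le_{cx}\nu$ (convex order); the pair $(\mu,\nu)$ is irreducible, i.e. for all Borel sets $A,B\subseteq\mathbb{R}$ with $\mu(A)>0$ and $\nu(B)>0$ there is a martingale $(M_t)_{0\le t\le 1}$ with $M_0\sim\mu$, $M_1\sim\nu$ and $\mathbb{P}(M_0\in A,\,M_1\in B)>0$; $C$ is compact; $\operatorname{supp}\mu\subseteq I$; $\nu$ is absolutely continuous with $\lambda\text{-}\operatorname{ess\,inf}_{I}\frac{d\nu}{d\lambda}>0$ and $\lambda\text{-}\operatorname{ess\,sup}_{\mathbb{R}}\frac{d\nu}{d\lambda}<\infty$. On a probability space $(\Omega,\mathcal{F},\mathbb{P})$ let $X\sim\mu$ and $\Gamma\sim N(0,1)$ be independent, $\mathcal{G}=\sigma(X)$, $\mathcal{H}=\sigma(X,\Gamma)$, and define the lifted Bass functional $$V(Z)=\sup\big\{\mathbb{E}[(Z+\Gamma)Y-ZX] : Y\in L^2(\mathcal{H};\mathbb{R}),\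 Y\sim\nu\big\},\qquad Z\in L^2(\mathcal{G};\mathbb{R}).$$ A Brenier potential from $\rho$ to $\eta$ is a convex $v:\mathbb{R}\to\mathbb{R}$ with $(\nabla v)_\#\rho=\eta$; its gradient $\nabla v$ is the Brenier map when $\rho$ is absolutely continuous. $Hv$ denotes the second derivative of $v$. Then: (0) $V$ is Fréchet differentiable on $L^2(\mathcal{G};\mathbb{R})$; write $D_ZV\in L^2(\mathcal{G};\mathbb{R})$ for its gradient at $Z$. For every $Z\in L^2(\mathcal{G};\mathbb{R})$ there is a Brenier potential from $\mathscr{L}(Z+\Gamma)$ to $\nu$, and every such potential is twice differentiable $\lambda$-almost everywhere. (1) Let $(Z_t)_{t\ge 0}$ be a continuously differentiable curve in $L^2(\mathcal{G};\mathbb{R})$ with derivative $G_t$. Then $t\mapsto D_{Z_t}V$ is a continuously differentiable curve in $L^2(\mathcal{G};\mathbb{R})$ and, for every $t\ge 0$ and every Brenier potential $v_t$ from $\mathscr{L}(Z_t+\Gamma)$ to $\nu$, $$\frac{d}{dt}\big(D_{Z_t}V\big)=\mathbb{E}\Big[Hv_t(Z_t+\Gamma)\big(G_t-\mathbb{E}[G_t\mid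 Z_t+\Gamma]\big)\,\Big|\,\mathcal{G}\Big],$$ where the random variable inside the conditional expectation is integrable. (2) Let $Z_0,Z_1\in L^2(\mathcal{G};\mathbb{R})$, $\Delta Z=Z_1-Z_0$ and $Z_t=Z_0+t\,\Delta Z$ for $t\in[0,1]$. Then $t\mapsto V(Z_t)$ is twice continuously differentiable on $[0,1]$ and, for every $t\in[0,1]$ and every Brenier potential $v_t$ from $\mathscr{L}(Z_t+\Gamma)$ to $\nu$, $$\frac{d^2}{dt^2}V(Z_t)=\mathbb{E}\Big[Hv_t(Z_t+\Gamma)\big(\Delta Z-\mathbb{E}[\Delta Z\mid Z_t+\Gamma]\big)^2\Big],$$ where the random variable inside the expectation is integrable. -/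

import Mathlib

open MeasureTheory ProbabilityTheory Set

noncomputable section

namespace Bass

/-- The convex order `μ ≤_cx ν`. A convex function is bounded below by an affine function, so for
measures with finite first moment its integral is always defined in `(-∞, ∞]`; the inequality is
void when the integral against `ν` is infinite. -/
def ConvexOrder (μ ν : Measure ℝ) : Prop :=
  ∀ φ : ℝ → ℝ, ConvexOn ℝ univ φ → Integrable φ ν →
    Integrable φ μ ∧ ∫ x, φ x ∂μ ≤ ∫ x, φ x ∂ν

/-- The pair `(μ, ν)` is irreducible: any two sets of positive measure are charged jointly by the
endpoints of some martingale, indexed by the times in `[0, 1]`, from `μ` to `ν`. -/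
def Irreducible (μ ν : Measure ℝ) : Prop :=
  ∀ A B : Set ℝ, MeasurableSet A → MeasurableSet B → 0 < μ A → 0 < ν B →
    ∃ (Ω : Type) (m : MeasurableSpace Ω) (Q : Measure Ω) (_ : IsProbabilityMeasure Q)
      (ℱ : Filtration (Icc (0 : ℝ) 1) m) (M : Icc (0 : ℝ) 1 → Ω → ℝ),
      Martingale M ℱ Q ∧ Q.map (M 0) = μ ∧ Q.map (M 1) = ν ∧
        0 < Q {ω | M 0 ω ∈ A ∧ M 1 ω ∈ B}

/-- `C_ν`, the convex hull of the support of `ν`. -/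
def hull (ν : Measure ℝ) : Set ℝ := convexHull ℝ ν.support

/-- Assumption (A): convex order, irreducibility, compactness of `C_ν`, and the support of `μ` lies
in the interior of `C_ν`. -/
structure AssumptionA (μ ν : Measure ℝ) : Prop where
  convexOrder : ConvexOrder μ ν
  irreducible : Irreducible μ ν
  isCompact_hull : IsCompact (hull ν)
  support_subset : μ.support ⊆ interior (hull ν)

/-- Assumption (A'): Assumption (A), and `ν` has a Lebesgue density which is essentially bounded
away from zero on the interior of `C_ν` and essentially bounded from above. -/
structure AssumptionA' (μ ν : Measure ℝ) : Prop extends AssumptionA μ ν where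
  absolutelyContinuous : ν ≪ volume
  essInf_pos : 0 < essInf (ν.rnDeriv volume) (volume.restrict (interior (hull ν)))
  essSup_lt_top : essSup (ν.rnDeriv volume) volume < ⊤

/-- `v` is a Brenier potential from `ρ` to `η`, i.e. `v` is a finite convex function whose
derivative (defined off a countable set) pushes `ρ` forward to `η`. Its derivative `deriv v` is the
Brenier map when `ρ` is absolutely continuous. -/
def IsBrenierPotential (v : ℝ → ℝ) (ρ η : Measure ℝ) : Prop :=
  ConvexOn ℝ univ v ∧ ρ.map (deriv v) = η

/-- The fixed data on a probability space `(Ω, P)`: a random variable `X ∼ μ` and an independent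
standard Gaussian `Γ`. -/
structure Setting {Ω : Type*} [mΩ : MeasurableSpace Ω] (P : Measure Ω) (μ : Measure ℝ) where
  X : Ω → ℝ
  Γ : Ω → ℝ
  measurable_X : Measurable X
  measurable_Γ : Measurable Γ
  map_X : P.map X = μ
  map_Γ : P.map Γ = gaussianReal 0 1
  indep : IndepFun X Γ P

namespace Setting

variable {Ω : Type*} [mΩ : MeasurableSpace Ω] {P : Measure Ω} {μ : Measure ℝ}

/-- `𝒢 = σ(X)`. -/
abbrev G (S : Setting P μ) : MeasurableSpace Ω := MeasurableSpace.comap S.X inferInstance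

/-- `ℋ = σ(X, Γ)`. -/
abbrev H (S : Setting P μ) : MeasurableSpace Ω :=
  MeasurableSpace.comap (fun ω => (S.X ω, S.Γ ω)) inferInstance

instance (S : Setting P μ) : Fact (S.G ≤ mΩ) := ⟨S.measurable_X.comap_le⟩

/-- The Hilbert space `L²(𝒢; ℝ)`, as a closed subspace of `L²(P)`. -/
abbrev L2G (S : Setting P μ) : Submodule ℝ (Lp ℝ 2 P) := lpMeas ℝ ℝ S.G 2 P

/-- The random variable `Z + Γ`. -/
def shift (S : Setting P μ) (Z : S.L2G) : Ω → ℝ := fun ω => (Z : Lp ℝ 2 P) ω + S.Γ ω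

/-- The lifted Bass functional
`V(Z) = sup { E[(Z + Γ) Y - Z X] : Y ∈ L²(ℋ), Y ∼ ν }` on `L²(𝒢)`. -/
def V (S : Setting P μ) (ν : Measure ℝ) (Z : S.L2G) : ℝ :=
  sSup {r : ℝ | ∃ Y : Ω → ℝ, Measurable[S.H] Y ∧ MemLp Y 2 P ∧ P.map Y = ν ∧
    r = ∫ ω, (((Z : Lp ℝ 2 P) ω + S.Γ ω) * Y ω - (Z : Lp ℝ 2 P) ω * S.X ω) ∂P}

/-- The conditional expectation `E[W | Z + Γ]`. -/
def condShift (S : Setting P μ) (Z W : S.L2G) : Ω → ℝ :=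
  P[((W : Lp ℝ 2 P) : Ω → ℝ) | MeasurableSpace.comap (S.shift Z) inferInstance]

/-- The random variable `W - E[W | Z + Γ]`. -/
def resid (S : Setting P μ) (Z W : S.L2G) : Ω → ℝ :=
  fun ω => (W : Lp ℝ 2 P) ω - S.condShift Z W ω

/-- The random variable `Hv(Z + Γ)`, with `Hv` the second derivative of `v`. -/
def hess (S : Setting P μ) (v : ℝ → ℝ) (Z : S.L2G) : Ω → ℝ :=
  fun ω => deriv (deriv v) (S.shift Z ω)

end Setting

end Bass

end

/-! On the line the optimal coupling is explicit. Let `F_Z` be the distribution function of `Z + Γ`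
and `Q` the quantile function of `ν`. The Brenier map is `T_Z = Q ∘ F_Z`, and the supremum in `V(Z)`
is attained at `Y_Z = Q(U_Z)` with `U_Z = F_Z(Z + Γ)` uniform on `[0, 1]` (`integral_shift_mul_le`,
`isGreatest_V`). The lower bound on the density of `ν` over a compact interval makes `Q` Lipschitz,
and the Gaussian makes `F_Z` smooth, with a positive density `p`.

As `V` is a supremum of functions affine in `Z`, `E[Y_Z - X | 𝒢]` is a subgradient at `Z`. It
depends continuously on `Z`, so it is the gradient (`hasGradientAt_V`).

It remains to differentiate `Y_Z` in a direction `W`. The chain rule gives `Q'(U_Z) (W p - r)` at `Z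
+ Γ`, where `r` is the density of the image of `W • P` (`hasDerivAt_optimizer_line`). Since `r / p`
represents `E[W | Z + Γ]` and `Hv = (Q' ∘ F_Z) p`, this equals `Hv(Z + Γ) (W - E[W | Z + Γ])`
(`sensitivity_ae_eq`). Projecting on `𝒢` gives the first formula. Pairing with `W`, and using that
the residual is orthogonal to functions of `Z + Γ`, gives the second.

The delicate point is continuity of this derivative in `Z`, because `Q'` is only bounded and
measurable. It holds because all `U_Z` have the same law (`continuous_sensitivityLp_left`). -/

namespace Bass

open Filter Topology
open scoped NNReal ENNReal

/-! ### Differentiability from subgradients, and convex functions of one variable. -/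

section Calculus

/-- A function with a continuous selection of subgradients is differentiable. -/
lemma hasGradientAt_of_forall_inner_le {E : Type*} [NormedAddCommGroup E] [InnerProductSpace ℝ E]
    [CompleteSpace E] {f : E → ℝ} {D : E → E} (h : ∀ y z, f y + inner ℝ (D y) (z - y) ≤ f z)
    (hD : Continuous D) (y : E) : HasGradientAt f (D y) y := by
  rw [hasGradientAt_iff_isLittleO, Asymptotics.isLittleO_iff]
  intro c hc
  have h1 : ∀ᶠ z in 𝓝 y, ‖D z - D y‖ < c := by
    have := (hD.tendsto y).sub_const (D y)
    rw [sub_self] at this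
    have := this.norm
    rw [norm_zero] at this
    exact this.eventually_lt_const hc
  filter_upwards [h1] with z hz
  -- The two subgradient inequalities give `0 ≤ f z - f y - ⟪D y, z - y⟫ ≤ ⟪D z - D y, z - y⟫`, and
  -- the right side is `o(‖z - y‖)` by continuity of `D`.
  have e1 := h y z
  have e2 := h z y
  have e3 : inner ℝ (D z) (y - z) = - inner ℝ (D z) (z - y) := by
    rw [← inner_neg_right, neg_sub]
  have e4 : inner ℝ (D z - D y) (z - y) ≤ ‖D z - D y‖ * ‖z - y‖ := real_inner_le_norm _ _
  rw [inner_sub_left] at e4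
  have e5 : ‖D z - D y‖ * ‖z - y‖ ≤ c * ‖z - y‖ := by gcongr
  rw [Real.norm_eq_abs, abs_le]
  constructor <;> nlinarith [norm_nonneg (z - y)]

/-- A Lipschitz function that has a directional derivative is differentiable along every curve
with that direction. -/
lemma hasDerivWithinAt_comp_of_lipschitzWith {E F : Type*} [NormedAddCommGroup E] [NormedSpace ℝ E]
    [NormedAddCommGroup F] [NormedSpace ℝ F] {f : E → F} {K : ℝ≥0} (hf : LipschitzWith K f)
    {γ : ℝ → E} {w : E} {a : F} {s : Set ℝ} {t : ℝ} (hγ : HasDerivWithinAt γ w s t)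
    (hline : HasDerivAt (fun h : ℝ => f (γ t + h • w)) a 0) :
    HasDerivWithinAt (fun r => f (γ r)) a s t := by
  have h1 : HasDerivWithinAt (fun r : ℝ => f (γ t + (r - t) • w)) a s t := by
    have h2 : HasDerivAt (fun r : ℝ => r - t) 1 t := (hasDerivAt_id t).sub_const t
    have h3 := HasDerivAt.scomp_of_eq t hline h2 (by simp)
    simpa [Function.comp_def] using h3.hasDerivWithinAt
  rw [hasDerivWithinAt_iff_isLittleO] at h1 hγ ⊢
  -- The curve is within `o(r - t)` of its tangent line, and a Lipschitz `f` preserves this order.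
  have h3 : (fun r => f (γ r) - f (γ t + (r - t) • w)) =o[𝓝[s] t] fun r => r - t := by
    refine Asymptotics.IsBigO.trans_isLittleO ?_ hγ
    refine Asymptotics.IsBigO.of_bound K (Eventually.of_forall fun r => ?_)
    have := hf.dist_le_mul (γ r) (γ t + (r - t) • w)
    rw [dist_eq_norm, dist_eq_norm] at this
    rwa [sub_sub]
  refine (h3.add h1).congr_left fun r => ?_
  simp only [sub_self, zero_smul, add_zero]
  abel

/-- The derivative of a convex function exists outside a countable set. -/
lemma countable_not_differentiableAt {v : ℝ → ℝ} (hv : ConvexOn ℝ univ v) :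
    {x | ¬ DifferentiableAt ℝ v x}.Countable := by
  have hmono : Monotone (fun x => derivWithin v (Ioi x) x) := by
    have := hv.monotoneOn_rightDeriv
    rw [interior_univ] at this
    exact monotoneOn_univ.1 this
  refine hmono.countable_not_continuousAt.mono fun x hx => ?_
  simp only [mem_ofPred_eq] at hx ⊢
  refine fun hc => hx ?_
  have hi : x ∈ interior (univ : Set ℝ) := by simp
  -- Both one-sided derivatives are compared with the slope over `[y, x]`. Letting `y ↑ x` at a
  -- continuity point of the right derivative, the two derivatives at `x` coincide.
  have hle : ∀ y, y < x → derivWithin v (Ioi y) y ≤ derivWithin v (Iio x) x := fun y hy =>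
    (hv.rightDeriv_le_slope_of_mem_interior (by simp) (mem_univ _) hy).trans
      (hv.slope_le_leftDeriv_of_mem_interior (mem_univ _) hi hy)
  have h1 : derivWithin v (Ioi x) x ≤ derivWithin v (Iio x) x := by
    refine le_of_tendsto (hc.tendsto.mono_left nhdsWithin_le_nhds : Tendsto _ (𝓝[<] x) _) ?_
    filter_upwards [self_mem_nhdsWithin] with y hy using hle y hy
  have h2 := hv.leftDeriv_le_rightDeriv_of_mem_interior hi
  have hr := hv.hasDerivWithinAt_rightDeriv_of_mem_interior hi
  have hl := hv.hasDerivWithinAt_leftDeriv_of_mem_interior hi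
  rw [le_antisymm h2 h1] at hl
  have hu := hl.union hr
  rw [Iio_union_Ioi] at hu
  have : HasDerivAt v (derivWithin v (Ioi x) x) x := by
    rwa [← hasDerivWithinAt_univ, ← hasDerivWithinAt_sdiff_singleton, ← compl_eq_univ_sdiff]
  exact this.differentiableAt

/-- The graph of a convex function lies above its tangents. -/
lemma add_mul_le_of_hasDerivAt {v : ℝ → ℝ} (hv : ConvexOn ℝ univ v) {x d : ℝ}
    (hd : HasDerivAt v d x) (y : ℝ) : v x + d * (y - x) ≤ v y := by
  rcases lt_trichotomy x y with h | rfl | h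
  · have := hv.le_slope_of_hasDerivAt (mem_univ _) (mem_univ _) h hd
    rw [slope_def_field, le_div_iff₀ (by linarith)] at this
    linarith
  · simp
  · have := hv.slope_le_of_hasDerivAt (mem_univ _) (mem_univ _) h hd
    rw [slope_def_field, div_le_iff₀ (by linarith)] at this
    linarith

/-- If the derivative of a convex function agrees with a continuous function wherever it exists,
then it exists everywhere. -/
lemma hasDerivAt_of_forall_differentiableAt {v T : ℝ → ℝ} (hv : ConvexOn ℝ univ v)
    (hT : Continuous T) (h : ∀ x, DifferentiableAt ℝ v x → deriv v x = T x) (x : ℝ) :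
    HasDerivAt v (T x) x := by
  have hvc : Continuous v := by
    rw [← continuousOn_univ]; exact hv.continuousOn isOpen_univ
  have key : ∀ y, DifferentiableAt ℝ v y → ∀ z, v y + T y * (z - y) ≤ v z := by
    intro y hy z
    have hd := hy.hasDerivAt
    rw [h y hy] at hd
    exact add_mul_le_of_hasDerivAt hv hd z
  have hdense : Dense {y | DifferentiableAt ℝ v y} := by
    have := (countable_not_differentiableAt hv).dense_compl ℝ
    convert this using 1
    ext; simp
  -- The tangent inequality is a closed condition on `y` and holds on a dense set, so `T` is a
  -- continuous selection of subgradients on the whole line.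
  have key2 : ∀ y z, v y + T y * (z - y) ≤ v z := by
    intro y z
    have hcl : IsClosed {y | v y + T y * (z - y) ≤ v z} :=
      isClosed_le (by fun_prop) continuous_const
    have : closure {y | DifferentiableAt ℝ v y} ⊆ {y | v y + T y * (z - y) ≤ v z} :=
      closure_minimal (fun y hy => key y hy z) hcl
    rw [hdense.closure_eq] at this
    exact this (mem_univ y)
  have := (hasGradientAt_of_forall_inner_le (f := v) (D := T)
    (fun y z => by simpa [mul_comm] using key2 y z) hT x).hasDerivAt
  simpa using this

end Calculus

/-! ### Convergence in `L²`. -/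

section L2

variable {Ω : Type*} [MeasurableSpace Ω] {P : Measure Ω}

lemma norm_sq_Lp_two (f : Lp ℝ 2 P) : ‖f‖ ^ 2 = ∫ ω, (f ω) ^ 2 ∂P := by
  rw [← real_inner_self_eq_norm_sq, L2.inner_def]
  simp [sq]

/-- The representatives `f'` and `g'` allow the bound and the limit to be checked on explicit
functions. -/
lemma tendsto_Lp_two_of_seq_dominated {f : ℕ → Lp ℝ 2 P} {g : Lp ℝ 2 P}
    {f' : ℕ → Ω → ℝ} {g' b : Ω → ℝ} (hb : MemLp b 2 P) (hf : ∀ i, f i =ᵐ[P] f' i)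
    (hg : g =ᵐ[P] g') (hle : ∀ i, ∀ᵐ ω ∂P, |f' i ω| ≤ b ω)
    (hlim : ∀ᵐ ω ∂P, Tendsto (fun i => f' i ω) atTop (𝓝 (g' ω))) : Tendsto f atTop (𝓝 g) := by
  rw [tendsto_iff_norm_sub_tendsto_zero]
  have h1 : Tendsto (fun i => ‖f i - g‖ ^ 2) atTop (𝓝 0) := by
    have e : ∀ i, ‖f i - g‖ ^ 2 = ∫ ω, (f' i ω - g' ω) ^ 2 ∂P := by
      intro i
      rw [norm_sq_Lp_two]
      refine integral_congr_ae ?_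
      filter_upwards [Lp.coeFn_sub (f i) g, hf i, hg] with ω h1 h2 h3
      rw [h1, Pi.sub_apply, h2, h3]
    simp_rw [e]
    have := tendsto_integral_of_dominated_convergence (μ := P) (F := fun i ω => (f' i ω - g' ω) ^ 2)
      (f := fun _ => (0 : ℝ)) (fun ω => (2 * b ω) ^ 2) ?_ ?_ ?_ ?_
    · simpa using this
    · intro i
      have h1 : AEStronglyMeasurable (f' i) P := (Lp.aestronglyMeasurable (f i)).congr (hf i)
      have h2 : AEStronglyMeasurable g' P := (Lp.aestronglyMeasurable g).congr hg
      exact (h1.sub h2).pow 2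
    · simpa [mul_pow] using (hb.integrable_sq.const_mul (2 ^ 2))
    · intro i
      filter_upwards [ae_all_iff.2 hle, hlim] with ω h1 h2
      have h3 : |g' ω| ≤ b ω := le_of_tendsto h2.abs (Eventually.of_forall fun i => h1 i)
      rw [Real.norm_eq_abs, abs_pow]
      gcongr
      calc |f' i ω - g' ω| ≤ |f' i ω| + |g' ω| := abs_sub _ _
        _ ≤ 2 * b ω := by linarith [h1 i]
    · filter_upwards [hlim] with ω h2
      have := (h2.sub_const (g' ω)).pow 2
      simpa using this
  have h2 := h1.sqrt
  simpa [Real.sqrt_sq] using h2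

/-- Dominated convergence in `L²`. -/
lemma tendsto_Lp_two_of_dominated {ι : Type*} {l : Filter ι} [l.IsCountablyGenerated]
    {f : ι → Lp ℝ 2 P} {g : Lp ℝ 2 P}
    {f' : ι → Ω → ℝ} {g' b : Ω → ℝ} (hb : MemLp b 2 P) (hf : ∀ i, f i =ᵐ[P] f' i)
    (hg : g =ᵐ[P] g') (hle : ∀ i, ∀ᵐ ω ∂P, |f' i ω| ≤ b ω)
    (hlim : ∀ᵐ ω ∂P, Tendsto (fun i => f' i ω) l (𝓝 (g' ω))) : Tendsto f l (𝓝 g) := by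
  refine tendsto_of_seq_tendsto fun u hu => ?_
  refine tendsto_Lp_two_of_seq_dominated hb (fun i => hf (u i)) hg (fun i => hle (u i)) ?_
  filter_upwards [hlim] with ω h using h.comp hu

/-- A convergent sequence in `L²` has an almost everywhere convergent subsequence. -/
lemma exists_subseq_tendsto_ae {f : ℕ → Lp ℝ 2 P} {g : Lp ℝ 2 P} (h : Tendsto f atTop (𝓝 g)) :
    ∃ ns : ℕ → ℕ, StrictMono ns ∧ ∀ᵐ ω ∂P, Tendsto (fun i => f (ns i) ω) atTop (𝓝 (g ω)) :=
  (tendstoInMeasure_of_tendsto_Lp h).exists_seq_tendsto_ae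

lemma integral_abs_le_norm [IsProbabilityMeasure P] (f : Lp ℝ 2 P) : ∫ ω, |f ω| ∂P ≤ ‖f‖ := by
  have h1 : (∫ ω, |f ω| ∂P) ^ 2 ≤ ‖f‖ ^ 2 := by
    rw [norm_sq_Lp_two]
    have hm : MemLp (fun ω => |f ω|) 2 P := (Lp.memLp f).norm
    have := variance_nonneg (fun ω => |f ω|) P
    rw [variance_eq_sub hm] at this
    simp only [Pi.pow_apply, sq_abs] at this
    linarith
  exact abs_le_of_sq_le_sq' h1 (norm_nonneg _) |>.2

/-- A measurable function of a convergent sequence of random variables converges in `L²` if all of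
them have the same law. -/
lemma tendsto_eLpNorm_comp_of_map_eq [IsProbabilityMeasure P] {U : ℕ → Ω → ℝ} {U₀ : Ω → ℝ}
    {ρ : Measure ℝ} [IsFiniteMeasure ρ]
    (hU : ∀ n, AEMeasurable (U n) P) (hU₀ : AEMeasurable U₀ P) (hmap : ∀ n, P.map (U n) = ρ)
    (hmap₀ : P.map U₀ = ρ)
    (hlim : ∀ᵐ ω ∂P, Tendsto (fun n => U n ω) atTop (𝓝 (U₀ ω))) {q : ℝ → ℝ} (hq : MemLp q 2 ρ) :
    Tendsto (fun n => eLpNorm (fun ω => q (U n ω) - q (U₀ ω)) 2 P) atTop (𝓝 0) := by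
  rw [ENNReal.tendsto_nhds_zero]
  intro ε hε
  have hε3 : ε / 3 ≠ 0 := by simp [hε.ne']
  -- Since every `U n` and `U₀` has law `ρ`, replacing `q` by a continuous `g` costs the same `ε /
  -- 3` for all of them. For `g` itself the almost sure limit suffices.
  obtain ⟨g, hg, gm⟩ := hq.exists_boundedContinuous_eLpNorm_sub_le (by simp) hε3
  have hsm : AEStronglyMeasurable (q - ⇑g) ρ := hq.1.sub g.continuous.aestronglyMeasurable
  have e1 : ∀ {W : Ω → ℝ}, AEMeasurable W P → P.map W = ρ →
      eLpNorm (fun ω => q (W ω) - g (W ω)) 2 P ≤ ε / 3 := by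
    intro W hW hWm
    have := eLpNorm_map_measure (p := 2) (μ := P) (f := W) (g := q - ⇑g) (by rwa [hWm]) hW
    rw [hWm] at this
    rw [show (fun ω => q (W ω) - g (W ω)) = (q - ⇑g) ∘ W from rfl, ← this]
    exact hg
  have msm : ∀ {W : Ω → ℝ}, AEMeasurable W P → P.map W = ρ →
      AEStronglyMeasurable (fun ω => q (W ω) - g (W ω)) P := by
    intro W hW hWm
    have : AEStronglyMeasurable (q - ⇑g) (P.map W) := by rwa [hWm]
    exact this.comp_aemeasurable hW
  have gsm : ∀ {W : Ω → ℝ}, AEMeasurable W P → AEStronglyMeasurable (fun ω => g (W ω)) P :=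
    fun hW => (g.continuous.measurable.comp_aemeasurable hW).aestronglyMeasurable
  have e2 : Tendsto (fun n => eLpNorm (fun ω => g (U n ω) - g (U₀ ω)) 2 P) atTop (𝓝 0) := by
    refine tendsto_Lp_finite_of_tendsto_ae (f := fun n ω => g (U n ω)) (g := fun ω => g (U₀ ω))
      (by norm_num) (by simp) (fun n => gsm (hU n)) ?_ ?_ ?_
    · exact MemLp.of_bound (gsm hU₀) ‖g‖ (Eventually.of_forall fun ω => g.norm_coe_le_norm _)
    · refine unifIntegrable_of (by norm_num) (by simp) (fun n => gsm (hU n)) fun δ hδ => ?_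
      refine ⟨‖g‖₊ + 1, fun n => ?_⟩
      have : {x | ‖g‖₊ + 1 ≤ ‖g (U n x)‖₊} = ∅ := by
        ext x
        simp only [mem_ofPred_eq, mem_empty_iff_false, iff_false, not_le]
        have : ‖g (U n x)‖₊ ≤ ‖g‖₊ := g.norm_coe_le_norm _
        exact this.trans_lt (lt_add_one _)
      simp [this]
    · filter_upwards [hlim] with ω h using (g.continuous.tendsto _).comp h
  filter_upwards [ENNReal.tendsto_nhds_zero.1 e2 (ε / 3) hε3.bot_lt] with n hn
  have : (fun ω => q (U n ω) - q (U₀ ω)) =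
      (fun ω => q (U n ω) - g (U n ω)) + (fun ω => g (U n ω) - g (U₀ ω))
        - (fun ω => q (U₀ ω) - g (U₀ ω)) := by
    ext ω; simp
  rw [this]
  refine (eLpNorm_sub_le ((msm (hU n) (hmap n)).add ((gsm (hU n)).sub (gsm hU₀)))
    (msm hU₀ hmap₀) (by norm_num)).trans ?_
  refine (add_le_add (eLpNorm_add_le (msm (hU n) (hmap n)) ((gsm (hU n)).sub (gsm hU₀))
    (by norm_num)) le_rfl).trans ?_
  refine (add_le_add (add_le_add (e1 (hU n) (hmap n)) hn) (e1 hU₀ hmap₀)).trans ?_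
  rw [ENNReal.add_thirds]

end L2

/-! ### The standard normal density and distribution function. -/

section Gaussian

/-- The standard normal density. -/
noncomputable def stdPDF : ℝ → ℝ := gaussianPDFReal 0 1

/-- The standard normal distribution function. -/
noncomputable def stdCDF (x : ℝ) : ℝ := cdf (gaussianReal 0 1) x

lemma stdPDF_pos (x : ℝ) : 0 < stdPDF x := gaussianPDFReal_pos _ _ _ one_ne_zero

lemma continuous_stdPDF : Continuous stdPDF := by
  unfold stdPDF
  rw [gaussianPDFReal_def]
  fun_prop

lemma stdPDF_le_one (x : ℝ) : stdPDF x ≤ 1 := by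
  unfold stdPDF gaussianPDFReal
  have h1 : (√(2 * Real.pi * (1 : ℝ≥0)))⁻¹ ≤ 1 := by
    apply inv_le_one_of_one_le₀
    rw [Real.one_le_sqrt]
    have := Real.pi_gt_three
    norm_num
    linarith
  have h2 : Real.exp (-(x - 0) ^ 2 / (2 * (1 : ℝ≥0))) ≤ 1 := by
    rw [Real.exp_le_one_iff]
    exact div_nonpos_of_nonpos_of_nonneg (neg_nonpos.2 (sq_nonneg _)) (by positivity)
  exact mul_le_one₀ h1 (Real.exp_pos _).le h2

lemma abs_stdPDF_le_one (x : ℝ) : |stdPDF x| ≤ 1 := by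
  rw [abs_of_pos (stdPDF_pos x)]; exact stdPDF_le_one x

lemma integrable_stdPDF : Integrable stdPDF := integrable_gaussianPDFReal 0 1

lemma integral_stdPDF : ∫ x, stdPDF x = 1 := integral_gaussianPDFReal_eq_one 0 one_ne_zero

lemma stdCDF_eq_integral (x : ℝ) : stdCDF x = ∫ y in Iic x, stdPDF y := by
  rw [stdCDF, cdf_eq_real, measureReal_def, gaussianReal_apply_eq_integral _ one_ne_zero,
    ENNReal.toReal_ofReal]
  · rfl
  · exact integral_nonneg fun y => gaussianPDFReal_nonneg _ _ _

lemma hasDerivAt_stdCDF (x : ℝ) : HasDerivAt stdCDF (stdPDF x) x := by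
  have h : stdCDF = fun y => (∫ t in (0 : ℝ)..y, stdPDF t) + stdCDF 0 := by
    ext y
    rw [stdCDF_eq_integral, stdCDF_eq_integral,
      ← intervalIntegral.integral_Iic_sub_Iic integrable_stdPDF.integrableOn
        integrable_stdPDF.integrableOn]
    ring
  rw [h]
  exact (intervalIntegral.integral_hasDerivAt_right (continuous_stdPDF.intervalIntegrable _ _)
    (continuous_stdPDF.stronglyMeasurableAtFilter _ _) continuous_stdPDF.continuousAt).add_const _

lemma continuous_stdCDF : Continuous stdCDF :=
  continuous_iff_continuousAt.2 fun x => (hasDerivAt_stdCDF x).continuousAt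

lemma abs_stdCDF_sub_le (x y : ℝ) : |stdCDF x - stdCDF y| ≤ |x - y| := by
  have : LipschitzWith 1 stdCDF := by
    refine lipschitzWith_of_nnnorm_deriv_le (fun x => (hasDerivAt_stdCDF x).differentiableAt)
      fun x => ?_
    rw [(hasDerivAt_stdCDF x).deriv]
    exact abs_stdPDF_le_one x
  simpa [Real.dist_eq] using this.dist_le_mul x y

lemma stdCDF_nonneg (x : ℝ) : 0 ≤ stdCDF x := cdf_nonneg _ _

lemma stdCDF_le_one (x : ℝ) : stdCDF x ≤ 1 := cdf_le_one _ _

lemma abs_stdCDF_le_one (x : ℝ) : |stdCDF x| ≤ 1 := by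
  rw [abs_of_nonneg (stdCDF_nonneg x)]; exact stdCDF_le_one x

lemma ofReal_stdCDF (x : ℝ) : ENNReal.ofReal (stdCDF x) = gaussianReal 0 1 (Iic x) := ofReal_cdf _ _

end Gaussian

/-! ### A Lipschitz quantile function of `ν`. -/

section Quantile

/-- `Q` is a Lipschitz quantile function of `ν`, extended to the whole line. -/
structure IsLipschitzQuantile (ν : Measure ℝ) (Q : ℝ → ℝ) (K : ℝ≥0) (M : ℝ) : Prop where
  lipschitz : LipschitzWith K Q
  monotone : Monotone Q
  abs_le : ∀ u, |Q u| ≤ M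
  injOn : InjOn Q (Icc 0 1)
  map_eq : (volume.restrict (Icc 0 1)).map Q = ν
  measure_singleton : ∀ y, ν {y} = 0
  apply_cdf : ∀ y, 0 < cdf ν y → cdf ν y < 1 → Q (cdf ν y) = y

lemma continuous_cdf_of_nullSingleton (ν : Measure ℝ) [IsProbabilityMeasure ν] [NullSingletonClass ν] :
    Continuous (cdf ν) := by
  rw [continuous_iff_continuousAt]
  intro x
  rw [(cdf ν).mono.continuousAt_iff_leftLim_eq_rightLim, StieltjesFunction.rightLim_eq]
  have h := (cdf ν).measure_singleton x
  rw [measure_cdf, measure_singleton] at h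
  have h2 := (cdf ν).mono.leftLim_le (le_refl x)
  have h3 := ENNReal.ofReal_eq_zero.1 h.symm
  linarith

/-- On `[a, b]` the distribution function expands distances by at least `c`, so its inverse is
Lipschitz with constant `c⁻¹`. -/
lemma exists_lipschitzQuantile_of_le_cdf {ν : Measure ℝ} [IsProbabilityMeasure ν] [NullSingletonClass ν]
    {a b c : ℝ} (hc : 0 < c) (hab : a ≤ b) (ha : cdf ν a = 0) (hb : cdf ν b = 1)
    (hlow : ∀ x y, a ≤ x → x ≤ y → y ≤ b → c * (y - x) ≤ cdf ν y - cdf ν x) :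
    ∃ Q K M, IsLipschitzQuantile ν Q K M := by
  have hcont := continuous_cdf_of_nullSingleton ν
  have hmono := monotone_cdf ν
  -- Clamping `u` to `[0, 1]` extends the inverse by constants, so it remains Lipschitz and monotone
  -- on `ℝ`.
  have hex : ∀ u : ℝ, ∃ x ∈ Icc a b, cdf ν x = (projIcc 0 1 zero_le_one u : ℝ) := by
    intro u
    have := intermediate_value_Icc hab hcont.continuousOn
    rw [ha, hb] at this
    exact this (projIcc 0 1 zero_le_one u).2
  choose Q hQm hQ using hex
  have hinv : ∀ x y, x ∈ Icc a b → y ∈ Icc a b → cdf ν x ≤ cdf ν y → x ≤ y := by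
    intro x y hx hy hxy
    by_contra! hlt
    have := hlow y x hy.1 hlt.le hx.2
    nlinarith
  have hQI : ∀ u ∈ Icc (0 : ℝ) 1, cdf ν (Q u) = u := by
    intro u hu
    rw [hQ, projIcc_of_mem _ hu]
  have hQmono : Monotone Q := fun u w huw =>
    hinv _ _ (hQm u) (hQm w) (by rw [hQ, hQ]; exact monotone_projIcc _ huw)
  -- The value `u = 0` is excluded: `Q 0 = a`, while `0 ≤ cdf ν x` also holds for `x < a`.
  have hle : ∀ u ∈ Ioc (0 : ℝ) 1, ∀ x, Q u ≤ x ↔ u ≤ cdf ν x := by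
    intro u hu x
    have hu' : u ∈ Icc (0 : ℝ) 1 := ⟨hu.1.le, hu.2⟩
    constructor
    · intro h
      rw [← hQI u hu']; exact hmono h
    · intro h
      by_contra! hlt
      rcases le_total a x with hax | hax
      · have h1 := hlow x (Q u) hax hlt.le (hQm u).2
        rw [hQI u hu'] at h1
        nlinarith
      · have := hmono hax
        linarith [hu.1]
  refine ⟨Q, Real.toNNReal c⁻¹, max |a| |b|, ?_, hQmono, ?_, ?_, ?_, fun y => measure_singleton y, ?_⟩
  · have h1 : ∀ u w, u ≤ w → Q w - Q u ≤ c⁻¹ * (w - u) := by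
      intro u w huw
      have e1 := hlow (Q u) (Q w) (hQm u).1 (hQmono huw) (hQm w).2
      rw [hQ, hQ] at e1
      have e2 := (LipschitzWith.projIcc (zero_le_one (α := ℝ))).dist_le_mul w u
      rw [Subtype.dist_eq, Real.dist_eq, Real.dist_eq, NNReal.coe_one, one_mul,
        abs_of_nonneg (sub_nonneg.2 huw)] at e2
      have e3 := (le_abs_self _).trans e2
      rw [le_inv_mul_iff₀ hc]
      linarith
    refine LipschitzWith.of_dist_le_mul fun u w => ?_
    rw [Real.dist_eq, Real.dist_eq, Real.coe_toNNReal _ (inv_nonneg.2 hc.le)]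
    rcases le_total u w with h | h
    · rw [abs_sub_comm, abs_sub_comm u, abs_of_nonneg (sub_nonneg.2 h),
        abs_of_nonneg (sub_nonneg.2 (hQmono h))]
      exact h1 u w h
    · rw [abs_of_nonneg (sub_nonneg.2 h), abs_of_nonneg (sub_nonneg.2 (hQmono h))]
      exact h1 w u h
  · intro u
    exact abs_le_max_abs_abs (hQm u).1 (hQm u).2
  · intro u hu w hw h
    rw [← hQI u hu, ← hQI w hw, h]
  · have : IsProbabilityMeasure (volume.restrict (Icc (0 : ℝ) 1)) := ⟨by simp⟩
    have : IsProbabilityMeasure ((volume.restrict (Icc (0 : ℝ) 1)).map Q) :=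
      Measure.isProbabilityMeasure_map hQmono.measurable.aemeasurable
    refine Measure.ext_of_Iic _ _ fun x => ?_
    rw [Measure.map_apply hQmono.measurable measurableSet_Iic, ← restrict_Ioc_eq_restrict_Icc,
      Measure.restrict_apply (hQmono.measurable measurableSet_Iic)]
    have : Q ⁻¹' Iic x ∩ Ioc 0 1 = Ioc 0 (cdf ν x) := by
      ext u
      constructor
      · rintro ⟨h1, h2⟩
        exact ⟨h2.1, (hle u h2 x).1 h1⟩
      · rintro ⟨h1, h2⟩
        have h3 : u ∈ Ioc (0 : ℝ) 1 := ⟨h1, h2.trans (cdf_le_one ν x)⟩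
        exact ⟨(hle u h3 x).2 h2, h3⟩
    rw [this, Real.volume_Ioc, sub_zero, ofReal_cdf]
  · intro y h0 h1
    have hI : cdf ν y ∈ Icc (0 : ℝ) 1 := ⟨h0.le, h1.le⟩
    have hy : y ∈ Icc a b := by
      constructor
      · by_contra! h; have := hmono h.le; linarith
      · by_contra! h; have := hmono h.le; linarith
    have h2 := hQI _ hI
    exact le_antisymm (hinv _ _ (hQm _) hy h2.le) (hinv _ _ hy (hQm _) h2.ge)

/-- The hull is a compact interval `[a, b]` carrying `ν`. Any positive `c` below the essential
infimum of the density gives `c (y - x) ≤ ν (x, y)` inside it. -/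
lemma AssumptionA'.exists_lipschitzQuantile {μ ν : Measure ℝ} [IsProbabilityMeasure ν]
    (hA : AssumptionA' μ ν) : ∃ Q K M, IsLipschitzQuantile ν Q K M := by
  have hna : NullSingletonClass ν := ⟨fun x => hA.absolutelyContinuous (measure_singleton x)⟩
  have hne : (hull ν).Nonempty :=
    (Measure.nonempty_support (IsProbabilityMeasure.ne_zero ν)).mono (subset_convexHull ℝ _)
  have hconv : Convex ℝ (hull ν) := convex_convexHull ℝ _
  obtain hI := eq_Icc_of_connected_compact ⟨hne, hconv.isPreconnected⟩ hA.isCompact_hull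
  set a := sInf (hull ν)
  set b := sSup (hull ν)
  have hab : a ≤ b := by
    rw [hI] at hne; exact nonempty_Icc.1 hne
  have hfull : ν (Icc a b)ᶜ = 0 := by
    refine measure_mono_null ?_ (Measure.measure_compl_support (μ := ν))
    rw [← hI]
    exact compl_subset_compl.2 (subset_convexHull ℝ _)
  have hpos := hA.essInf_pos
  obtain ⟨c, hc0, hc⟩ := ENNReal.lt_iff_exists_nnreal_btwn.1 hpos
  have hae := ae_lt_of_lt_essInf hc
  rw [hI, interior_Icc] at hae
  refine exists_lipschitzQuantile_of_le_cdf (a := a) (b := b) (c := c) (by exact_mod_cast hc0) hab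
    ?_ ?_ ?_
  · rw [cdf_eq_real, measureReal_eq_zero_iff, ← Iio_union_right, measure_union_null_iff]
    refine ⟨measure_mono_null ?_ hfull, measure_singleton _⟩
    intro x hx hx'
    exact absurd hx'.1 (not_le.2 hx)
  · have h1 : ν (Iic b) = 1 := (prob_compl_eq_zero_iff measurableSet_Iic).1
      (measure_mono_null (compl_subset_compl.2 Icc_subset_Iic_self) hfull)
    rw [cdf_eq_real, measureReal_def, h1, ENNReal.toReal_one]
  · intro x y hax hxy hyb
    have h1 : (c : ℝ≥0∞) * volume (Ioo x y) ≤ ν (Ioo x y) := by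
      rw [← Measure.withDensity_rnDeriv_eq ν volume hA.absolutelyContinuous,
        withDensity_apply _ measurableSet_Ioo, ← setLIntegral_const]
      refine lintegral_mono_ae ?_
      have h2 := ae_mono (Measure.restrict_mono (Ioo_subset_Ioo hax hyb) le_rfl) hae
      filter_upwards [h2] with t ht using ht.le
    have h2 : ν (Ioo x y) ≤ ν (Ioc x y) := measure_mono Ioo_subset_Ioc_self
    have h3 := h1.trans h2
    conv_rhs at h3 => rw [← measure_cdf ν]
    rw [StieltjesFunction.measure_Ioc, Real.volume_Ioo] at h3
    have h4 : ENNReal.ofReal (c * (y - x)) ≤ ENNReal.ofReal (cdf ν y - cdf ν x) := by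
      rwa [ENNReal.ofReal_mul c.coe_nonneg, ENNReal.ofReal_coe_nnreal]
    exact (ENNReal.ofReal_le_ofReal_iff (sub_nonneg.2 (monotone_cdf ν hxy))).1 h4

end Quantile

/-! ### Gaussian smoothing: the distribution function and density of `Z + Γ`. -/

section Smoothing

variable {Ω : Type*} [MeasurableSpace Ω]

/-- The distribution function of the sum of `Z` and an independent standard Gaussian. -/
noncomputable def shiftCDF (P : Measure Ω) (Z : Ω → ℝ) (x : ℝ) : ℝ := ∫ ω, stdCDF (x - Z ω) ∂P

/-- The density with respect to Lebesgue measure of the image under `Z + Γ` of the signed measure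
with density `W`, when `(Z, W)` and the standard Gaussian `Γ` are independent. -/
noncomputable def smoothing (P : Measure Ω) (Z W : Ω → ℝ) (x : ℝ) : ℝ :=
  ∫ ω, stdPDF (x - Z ω) * W ω ∂P

variable {P : Measure Ω} [IsProbabilityMeasure P] {Z Z' W : Ω → ℝ}

lemma integrable_stdCDF_sub (hZ : AEStronglyMeasurable Z P) (x : ℝ) :
    Integrable (fun ω => stdCDF (x - Z ω)) P :=
  Integrable.of_bound (continuous_stdCDF.comp_aestronglyMeasurable (aestronglyMeasurable_const.sub hZ)) 1
    (Eventually.of_forall fun _ => abs_stdCDF_le_one _)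

lemma abs_stdPDF_mul_le (x w : ℝ) : |stdPDF x * w| ≤ |w| := by
  rw [abs_mul]
  exact mul_le_of_le_one_left (abs_nonneg _) (abs_stdPDF_le_one _)

omit [IsProbabilityMeasure P] in
lemma integrable_stdPDF_sub_mul (hZ : AEStronglyMeasurable Z P) (hW : Integrable W P) (x : ℝ) :
    Integrable (fun ω => stdPDF (x - Z ω) * W ω) P :=
  hW.mono ((continuous_stdPDF.comp_aestronglyMeasurable (aestronglyMeasurable_const.sub hZ)).mul hW.1)
    (Eventually.of_forall fun _ => abs_stdPDF_mul_le _ _)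

omit [IsProbabilityMeasure P] in
lemma abs_smoothing_le (x : ℝ) (hW : Integrable W P) : |smoothing P Z W x| ≤ ∫ ω, |W ω| ∂P := by
  rw [← Real.norm_eq_abs]
  exact norm_integral_le_of_norm_le hW.abs (Eventually.of_forall fun _ => abs_stdPDF_mul_le _ _)

lemma smoothing_one_pos (hZ : AEStronglyMeasurable Z P) (x : ℝ) :
    0 < smoothing P Z (fun _ => 1) x := by
  unfold smoothing
  rw [integral_pos_iff_support_of_nonneg (fun ω => by simpa using (stdPDF_pos _).le)
    (integrable_stdPDF_sub_mul hZ (integrable_const 1) x)]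
  have : (Function.support fun ω => stdPDF (x - Z ω) * 1) = univ := by
    ext ω; simp [(stdPDF_pos _).ne']
  rw [this]; simp

omit [IsProbabilityMeasure P] in
lemma smoothing_congr (hZ : Z =ᵐ[P] Z') {W' : Ω → ℝ} (hW : W =ᵐ[P] W') (x : ℝ) :
    smoothing P Z W x = smoothing P Z' W' x :=
  integral_congr_ae (by filter_upwards [hZ, hW] with ω h1 h2 using by rw [h1, h2])

omit [IsProbabilityMeasure P] in
lemma shiftCDF_congr (hZ : Z =ᵐ[P] Z') (x : ℝ) : shiftCDF P Z x = shiftCDF P Z' x :=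
  integral_congr_ae (by filter_upwards [hZ] with ω h1 using by rw [h1])

omit [IsProbabilityMeasure P] in
lemma tendsto_smoothing {ι : Type*} {l : Filter ι} [l.IsCountablyGenerated] {z : ι → Ω → ℝ}
    {y : ι → ℝ} {x : ℝ} (hz : ∀ i, AEStronglyMeasurable (z i) P) (hW : Integrable W P)
    (hlim : ∀ᵐ ω ∂P, Tendsto (fun i => z i ω) l (𝓝 (Z ω))) (hy : Tendsto y l (𝓝 x)) :
    Tendsto (fun i => smoothing P (z i) W (y i)) l (𝓝 (smoothing P Z W x)) := by
  refine tendsto_integral_filter_of_dominated_convergence (fun ω => |W ω|)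
    (Eventually.of_forall fun i => (integrable_stdPDF_sub_mul (hz i) hW _).1)
    (Eventually.of_forall fun i => Eventually.of_forall fun ω => abs_stdPDF_mul_le _ _) hW.abs ?_
  filter_upwards [hlim] with ω h
  exact ((continuous_stdPDF.tendsto _).comp (hy.sub h)).mul_const _

omit [IsProbabilityMeasure P] in
lemma continuous_smoothing (hZ : AEStronglyMeasurable Z P) (hW : Integrable W P) :
    Continuous (smoothing P Z W) :=
  continuous_iff_continuousAt.2 fun _ => tendsto_smoothing (fun _ => hZ) hW
    (Eventually.of_forall fun _ => tendsto_const_nhds) tendsto_id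

/-- The normal distribution function is `1`-Lipschitz. This joint estimate in the point and in `Z`
supplies both the Lipschitz bounds and the dominating functions used later. -/
lemma abs_shiftCDF_sub_le (hZ : Integrable Z P) (hZ' : Integrable Z' P) (x x' : ℝ) :
    |shiftCDF P Z x - shiftCDF P Z' x'| ≤ |x - x'| + ∫ ω, |Z ω - Z' ω| ∂P := by
  unfold shiftCDF
  rw [← integral_sub (integrable_stdCDF_sub hZ.1 x) (integrable_stdCDF_sub hZ'.1 x')]
  have h : |x - x'| + ∫ ω, |Z ω - Z' ω| ∂P = ∫ ω, (|x - x'| + |Z ω - Z' ω|) ∂P := by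
    have := integral_add (integrable_const |x - x'|) (hZ.sub hZ').abs
    simp only [integral_const, probReal_univ, smul_eq_mul, one_mul, Pi.sub_apply] at this
    exact this.symm
  rw [h, ← Real.norm_eq_abs]
  refine norm_integral_le_of_norm_le (g := fun ω => |x - x'| + |Z ω - Z' ω|)
    ((integrable_const _).add (hZ.sub hZ').abs) (Eventually.of_forall fun ω => ?_)
  refine (abs_stdCDF_sub_le _ _).trans ?_
  rw [show x - Z ω - (x' - Z' ω) = (x - x') - (Z ω - Z' ω) by ring]
  exact abs_sub _ _

lemma continuous_shiftCDF (hZ : Integrable Z P) : Continuous (shiftCDF P Z) := by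
  have : LipschitzWith 1 (shiftCDF P Z) := LipschitzWith.of_dist_le_mul fun x y => by
    simpa [Real.dist_eq] using abs_shiftCDF_sub_le hZ hZ x y
  exact this.continuous

/-- Point and random variable move together because `Z` enters `F_Z(Z + Γ)` twice. Differentiation
under the integral is dominated by `|w - W|`, the normal density being at most `1`. -/
lemma hasDerivAt_shiftCDF_line (hZ : Integrable Z P) (hW : Integrable W P) (x w : ℝ) :
    HasDerivAt (fun h : ℝ => shiftCDF P (fun ω => Z ω + h * W ω) (x + h * w))
      (w * smoothing P Z (fun _ => 1) x - smoothing P Z W x) 0 := by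
  have hi1 := integrable_stdPDF_sub_mul hZ.1 (integrable_const (1 : ℝ)) x
  have hi2 := integrable_stdPDF_sub_mul hZ.1 hW x
  have h := hasDerivAt_integral_of_dominated_loc_of_deriv_le (μ := P) (x₀ := (0 : ℝ)) (s := univ)
    (F := fun h ω => stdCDF (x + h * w - (Z ω + h * W ω)))
    (F' := fun h ω => stdPDF (x + h * w - (Z ω + h * W ω)) * (w - W ω))
    (bound := fun ω => |w - W ω|) univ_mem
    (Eventually.of_forall fun h =>
      (integrable_stdCDF_sub (hZ.1.add (hW.1.const_mul h)) (x + h * w)).1)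
    (integrable_stdCDF_sub (hZ.1.add (hW.1.const_mul 0)) (x + 0 * w)) ?_
    (Eventually.of_forall fun ω h _ => abs_stdPDF_mul_le _ _)
    ((integrable_const w).sub hW).abs ?_
  · refine h.2.congr_deriv ?_
    unfold smoothing
    rw [← integral_const_mul, ← integral_sub (hi1.const_mul w) hi2]
    refine integral_congr_ae (Eventually.of_forall fun ω => ?_)
    simp
    ring
  · exact (integrable_stdPDF_sub_mul (hZ.1.add (hW.1.const_mul 0))
      ((integrable_const w).sub hW) (x + 0 * w)).1
  · refine Eventually.of_forall fun ω h _ => ?_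
    refine (hasDerivAt_stdCDF _).comp h ?_
    have h1 : HasDerivAt (fun h : ℝ => x + h * w) (1 * w) h :=
      ((hasDerivAt_id h).mul_const w).const_add x
    have h2 : HasDerivAt (fun h : ℝ => Z ω + h * W ω) (1 * W ω) h :=
      ((hasDerivAt_id h).mul_const (W ω)).const_add (Z ω)
    have h3 := h1.sub h2
    rw [one_mul, one_mul] at h3
    exact h3

lemma hasDerivAt_shiftCDF (hZ : Integrable Z P) (x : ℝ) :
    HasDerivAt (shiftCDF P Z) (smoothing P Z (fun _ => 1) x) x := by
  have h := hasDerivAt_shiftCDF_line hZ (integrable_zero Ω ℝ P) x 1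
  have h2 : HasDerivAt (fun y : ℝ => y - x) 1 x := (hasDerivAt_id x).sub_const x
  have h3 := HasDerivAt.scomp_of_eq x h h2 (by simp)
  simpa [Function.comp_def, smoothing] using h3

lemma strictMono_shiftCDF (hZ : Integrable Z P) : StrictMono (shiftCDF P Z) :=
  strictMono_of_hasDerivAt_pos (hasDerivAt_shiftCDF hZ) (smoothing_one_pos hZ.1)

lemma shiftCDF_mem_Ioo (hZ : Integrable Z P) (x : ℝ) : shiftCDF P Z x ∈ Ioo (0 : ℝ) 1 := by
  have h0 : ∀ y, 0 ≤ shiftCDF P Z y := fun y => integral_nonneg fun _ => stdCDF_nonneg _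
  have h1 : ∀ y, shiftCDF P Z y ≤ 1 := fun y => by
    have := integral_mono (integrable_stdCDF_sub hZ.1 y) (integrable_const (1 : ℝ))
      (fun _ => stdCDF_le_one _)
    simpa [shiftCDF] using this
  exact ⟨(h0 (x - 1)).trans_lt (strictMono_shiftCDF hZ (by linarith)),
    (strictMono_shiftCDF hZ (by linarith : x < x + 1)).trans_le (h1 _)⟩

end Smoothing

/-! ### The law of `Z + Γ`, and its transformation to the uniform law. -/

section Laws

/-- A strictly increasing continuous distribution function transforms its law into the uniform
distribution. -/
lemma map_cdf_eq_uniform (ρ : Measure ℝ) [IsProbabilityMeasure ρ] (hc : Continuous (cdf ρ))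
    (hm : StrictMono (cdf ρ)) : ρ.map (cdf ρ) = volume.restrict (Icc 0 1) := by
  have : IsProbabilityMeasure (volume.restrict (Icc (0 : ℝ) 1)) := ⟨by simp⟩
  have : IsProbabilityMeasure (ρ.map (cdf ρ)) :=
    Measure.isProbabilityMeasure_map hc.measurable.aemeasurable
  have h0 : ∀ x, 0 < cdf ρ x := fun x =>
    (cdf_nonneg ρ (x - 1)).trans_lt (hm (by linarith))
  refine Measure.ext_of_Iic _ _ fun a => ?_
  rw [Measure.map_apply hc.measurable measurableSet_Iic, ← restrict_Ioc_eq_restrict_Icc,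
    Measure.restrict_apply measurableSet_Iic]
  rcases le_or_gt a 0 with ha | ha
  · have e1 : cdf ρ ⁻¹' Iic a = ∅ := by
      ext x; simp only [mem_preimage, mem_Iic, mem_empty_iff_false, iff_false, not_le]
      exact ha.trans_lt (h0 x)
    have e2 : Iic a ∩ Ioc 0 1 = ∅ := by
      ext x; simp only [mem_inter_iff, mem_Iic, mem_Ioc, mem_empty_iff_false, iff_false]
      rintro ⟨h1, h2, -⟩; linarith
    rw [e1, e2, measure_empty, measure_empty]
  rcases le_or_gt 1 a with ha1 | ha1
  · have e1 : cdf ρ ⁻¹' Iic a = univ := by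
      ext x; simp only [mem_preimage, mem_Iic, mem_univ, iff_true]
      exact (cdf_le_one ρ x).trans ha1
    have e2 : Iic a ∩ Ioc 0 1 = Ioc 0 1 := by
      rw [inter_eq_right]; exact fun x hx => hx.2.trans ha1
    rw [e1, e2, measure_univ]; simp
  · obtain ⟨x, hx⟩ : a ∈ range (cdf ρ) := by
      refine mem_range_of_exists_le_of_exists_ge hc ?_ ?_
      · exact (((tendsto_cdf_atBot ρ).eventually_lt_const ha).exists).imp fun _ h => h.le
      · exact (((tendsto_cdf_atTop ρ).eventually_const_lt ha1).exists).imp fun _ h => h.le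
    have e1 : cdf ρ ⁻¹' Iic a = Iic x := by
      ext y; simp only [mem_preimage, mem_Iic, ← hx, hm.le_iff_le]
    have e2 : Iic a ∩ Ioc 0 1 = Ioc 0 a := by
      ext y; simp only [mem_inter_iff, mem_Iic, mem_Ioc]
      constructor
      · rintro ⟨h1, h2, -⟩; exact ⟨h2, h1⟩
      · rintro ⟨h1, h2⟩; exact ⟨h2, h1, h2.trans ha1.le⟩
    rw [e1, e2, Real.volume_Ioc, sub_zero, ← hx, ofReal_cdf]

variable {Ω : Type*} [MeasurableSpace Ω] {P : Measure Ω} [IsProbabilityMeasure P] {Z W Γ : Ω → ℝ}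

/-- By independence and Fubini: given `Z`, the event `Z + Γ ≤ x` has Gaussian mass `stdCDF (x - Z)`.
-/
lemma map_add_Iic (hZ : Measurable Z) (hΓ : Measurable Γ) (hmap : P.map Γ = gaussianReal 0 1)
    (hind : IndepFun Z Γ P) (x : ℝ) :
    P.map (fun ω => Z ω + Γ ω) (Iic x) = ENNReal.ofReal (shiftCDF P Z x) := by
  have hs : MeasurableSet {q : ℝ × ℝ | q.1 + q.2 ≤ x} :=
    measurableSet_le (by fun_prop) measurable_const
  have e1 : P.map (fun ω => Z ω + Γ ω) (Iic x) =
      P.map (fun ω => (Z ω, Γ ω)) {q : ℝ × ℝ | q.1 + q.2 ≤ x} := by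
    rw [Measure.map_apply (by fun_prop) measurableSet_Iic, Measure.map_apply (by fun_prop) hs]
    rfl
  rw [e1, (indepFun_iff_map_prod_eq_prod_map_map hZ.aemeasurable hΓ.aemeasurable).1 hind, hmap,
    Measure.prod_apply hs, lintegral_map (measurable_measure_prodMk_left hs) hZ, shiftCDF,
    ofReal_integral_eq_lintegral_ofReal (integrable_stdCDF_sub hZ.aestronglyMeasurable x)
      (Eventually.of_forall fun _ => stdCDF_nonneg _)]
  refine lintegral_congr fun ω => ?_
  rw [ofReal_stdCDF]
  congr 1
  ext y
  simp [le_sub_iff_add_le']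

omit [IsProbabilityMeasure P] in
lemma integrable_stdPDF_mul_prod (hZ : Measurable Z) (hW : Integrable W P) :
    Integrable (fun q : Ω × ℝ => stdPDF (q.2 - Z q.1) * W q.1) (P.prod volume) := by
  have hm : AEStronglyMeasurable (fun q : Ω × ℝ => stdPDF (q.2 - Z q.1) * W q.1)
      (P.prod volume) := by
    refine AEStronglyMeasurable.mul ?_ hW.1.comp_fst
    exact (continuous_stdPDF.measurable.comp
      (measurable_snd.sub (hZ.comp measurable_fst))).aestronglyMeasurable
  rw [integrable_prod_iff hm]
  refine ⟨Eventually.of_forall fun ω => (integrable_stdPDF.comp_sub_right (Z ω)).mul_const (W ω), ?_⟩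
  refine hW.abs.congr (Eventually.of_forall fun ω => ?_)
  simp only [norm_mul, Real.norm_eq_abs, abs_of_pos (stdPDF_pos _)]
  rw [integral_mul_const, integral_sub_right_eq_self (fun y => stdPDF y), integral_stdPDF, one_mul]

lemma integrable_smoothing (hZ : Measurable Z) (hW : Integrable W P) :
    Integrable (smoothing P Z W) :=
  (integrable_stdPDF_mul_prod hZ hW).integral_prod_right

/-- `smoothing P Z W` is the density of the image of `W • P` under `Z + Γ`. -/
lemma setIntegral_preimage_add (hZ : Measurable Z) (hW : Integrable W P) (hWm : Measurable W)
    (hΓ : Measurable Γ) (hmap : P.map Γ = gaussianReal 0 1)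
    (hind : IndepFun (fun ω => (Z ω, W ω)) Γ P) {B : Set ℝ} (hB : MeasurableSet B) :
    ∫ ω in (fun ω => Z ω + Γ ω) ⁻¹' B, W ω ∂P = ∫ x in B, smoothing P Z W x := by
  have hBm : MeasurableSet ((fun ω => Z ω + Γ ω) ⁻¹' B) := (hZ.add hΓ) hB
  set k : (ℝ × ℝ) × ℝ → ℝ := fun q => B.indicator 1 (q.1.1 + q.2) * q.1.2 with hk
  have hkm : Measurable k := by
    refine Measurable.mul ?_ (by fun_prop)
    exact (measurable_one.indicator hB).comp (by fun_prop)
  have hT : Measurable (fun ω => ((Z ω, W ω), Γ ω)) := by fun_prop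
  have e1 : ∫ ω in (fun ω => Z ω + Γ ω) ⁻¹' B, W ω ∂P = ∫ ω, k ((Z ω, W ω), Γ ω) ∂P := by
    rw [← integral_indicator hBm]
    refine integral_congr_ae (Eventually.of_forall fun ω => ?_)
    by_cases hm : Z ω + Γ ω ∈ B <;> simp [hk, indicator, hm]
  have hlaw := (indepFun_iff_map_prod_eq_prod_map_map (hZ.prodMk hWm).aemeasurable
    hΓ.aemeasurable).1 hind
  rw [hmap] at hlaw
  have hki : Integrable k ((P.map fun ω => (Z ω, W ω)).prod (gaussianReal 0 1)) := by
    rw [← hlaw, integrable_map_measure hkm.aestronglyMeasurable hT.aemeasurable]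
    refine hW.mono (hkm.comp hT).aestronglyMeasurable (Eventually.of_forall fun ω => ?_)
    simp only [hk, Function.comp, indicator]
    split_ifs <;> simp
  have e2 : ∫ ω, k ((Z ω, W ω), Γ ω) ∂P = ∫ ω, ∫ y, k ((Z ω, W ω), y) ∂(gaussianReal 0 1) ∂P := by
    rw [← integral_map (f := k) hT.aemeasurable hkm.aestronglyMeasurable, hlaw, integral_prod _ hki,
      integral_map (hZ.prodMk hWm).aemeasurable]
    exact hki.1.integral_prod_right'
  -- The translation `x = Z + y` moves the dependence on `Z` from the set into the Gaussian density.
  -- Exchanging the integrals then produces `smoothing`.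
  have e3 : ∀ ω, ∫ y, k ((Z ω, W ω), y) ∂(gaussianReal 0 1) =
      ∫ x in B, stdPDF (x - Z ω) * W ω := by
    intro ω
    rw [integral_gaussianReal_eq_integral_smul one_ne_zero, ← integral_indicator hB,
      ← integral_sub_right_eq_self _ (Z ω)]
    refine integral_congr_ae (Eventually.of_forall fun x => ?_)
    simp only [hk, indicator, stdPDF, smul_eq_mul]
    rw [add_sub_cancel]
    split_ifs <;> simp
  rw [e1, e2]
  simp_rw [e3]
  rw [integral_integral_swap]
  · rfl
  · have := (integrable_stdPDF_mul_prod hZ hW).restrict (s := univ ×ˢ B)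
    rw [← Measure.prod_restrict, Measure.restrict_univ] at this
    exact this

lemma map_add_eq_withDensity (hZ : Measurable Z) (hΓ : Measurable Γ)
    (hmap : P.map Γ = gaussianReal 0 1) (hind : IndepFun Z Γ P) :
    P.map (fun ω => Z ω + Γ ω) =
      volume.withDensity fun x => ENNReal.ofReal (smoothing P Z (fun _ => 1) x) := by
  have hind' : IndepFun (fun ω => (Z ω, (1 : ℝ))) Γ P :=
    hind.comp (φ := fun z => (z, (1 : ℝ))) (ψ := id) (by fun_prop) measurable_id
  ext B hB
  have h := setIntegral_preimage_add hZ (integrable_const 1) measurable_const hΓ hmap hind' hB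
  rw [Measure.map_apply (by fun_prop) hB, withDensity_apply _ hB,
    ← ofReal_integral_eq_lintegral_ofReal
      (integrable_smoothing hZ (integrable_const (1 : ℝ))).restrict
      (Eventually.of_forall fun x => (smoothing_one_pos hZ.aestronglyMeasurable x).le), ← h]
  simp

end Laws

/-! ### Consequences for `Z ∈ L²(𝒢)`: independence, laws and conditional expectations. -/

namespace Setting

variable {Ω : Type*} [MeasurableSpace Ω] {P : Measure Ω} {μ : Measure ℝ} (S : Setting P μ)

lemma measurable_coe (Z : S.L2G) : Measurable ((Z : Lp ℝ 2 P) : Ω → ℝ) :=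
  (Lp.stronglyMeasurable _).measurable

lemma measurable_shift (Z : S.L2G) : Measurable (S.shift Z) :=
  (S.measurable_coe Z).add S.measurable_Γ

/-- Doob–Dynkin factorization. It carries the independence of `X` and `Γ` over to `Z`, and later
yields an `ℋ`-measurable version of the optimizer. -/
lemma exists_ae_eq_comp (Z : S.L2G) :
    ∃ z : ℝ → ℝ, Measurable z ∧ ((Z : Lp ℝ 2 P) : Ω → ℝ) =ᵐ[P] z ∘ S.X := by
  obtain ⟨g, hg, hZ⟩ := mem_lpMeas_iff_aestronglyMeasurable.1 Z.2
  obtain ⟨z, hz, rfl⟩ := Measurable.exists_eq_measurable_comp hg.measurable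
  exact ⟨z, hz, hZ⟩

lemma indepFun_prodMk (Z W : S.L2G) :
    IndepFun (fun ω => ((Z : Lp ℝ 2 P) ω, (W : Lp ℝ 2 P) ω)) S.Γ P := by
  obtain ⟨z, hz, hZ⟩ := S.exists_ae_eq_comp Z
  obtain ⟨w, hw, hW⟩ := S.exists_ae_eq_comp W
  have h := S.indep.comp (φ := fun x => (z x, w x)) (ψ := id) (hz.prodMk hw) measurable_id
  refine h.congr ?_ (ae_eq_refl _)
  filter_upwards [hZ, hW] with ω h1 h2
  simp [h1, h2]

lemma indepFun_coe (Z : S.L2G) : IndepFun ((Z : Lp ℝ 2 P) : Ω → ℝ) S.Γ P :=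
  (S.indepFun_prodMk Z Z).comp measurable_fst measurable_id

variable [IsProbabilityMeasure P]

lemma integrable_coe (Z : Lp ℝ 2 P) : Integrable (Z : Ω → ℝ) P :=
  (Lp.memLp Z).integrable (by norm_num)

instance (Z : S.L2G) : IsProbabilityMeasure (P.map (S.shift Z)) :=
  Measure.isProbabilityMeasure_map (S.measurable_shift Z).aemeasurable

lemma cdf_map_shift (Z : S.L2G) :
    ⇑(cdf (P.map (S.shift Z))) = shiftCDF P (Z : Lp ℝ 2 P) := by
  ext x
  have h := map_add_Iic (S.measurable_coe Z) S.measurable_Γ S.map_Γ (S.indepFun_coe Z) x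
  rw [cdf_eq_real, measureReal_def]
  unfold shift
  rw [h, ENNReal.toReal_ofReal]
  exact (shiftCDF_mem_Ioo (integrable_coe _) x).1.le

lemma map_shift_eq_withDensity (Z : S.L2G) : P.map (S.shift Z) =
    volume.withDensity fun x => ENNReal.ofReal (smoothing P (Z : Lp ℝ 2 P) (fun _ => 1) x) :=
  map_add_eq_withDensity (S.measurable_coe Z) S.measurable_Γ S.map_Γ (S.indepFun_coe Z)

/-- The uniform random variable obtained by applying to `Z + Γ` its distribution function. -/
noncomputable def unif (Z : S.L2G) (ω : Ω) : ℝ := shiftCDF P (Z : Lp ℝ 2 P) (S.shift Z ω)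

lemma measurable_unif (Z : S.L2G) : Measurable (S.unif Z) :=
  (continuous_shiftCDF (integrable_coe _)).measurable.comp (S.measurable_shift Z)

lemma map_shift_shiftCDF (Z : S.L2G) :
    (P.map (S.shift Z)).map (shiftCDF P (Z : Lp ℝ 2 P)) = volume.restrict (Icc 0 1) := by
  rw [← S.cdf_map_shift Z]
  refine map_cdf_eq_uniform _ ?_ ?_
  · rw [S.cdf_map_shift Z]; exact continuous_shiftCDF (integrable_coe _)
  · rw [S.cdf_map_shift Z]; exact strictMono_shiftCDF (integrable_coe _)

lemma map_unif (Z : S.L2G) : P.map (S.unif Z) = volume.restrict (Icc 0 1) := by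
  rw [← S.map_shift_shiftCDF Z, Measure.map_map
    (continuous_shiftCDF (integrable_coe _)).measurable (S.measurable_shift Z)]
  rfl

/-- `E[W | Z + Γ]` as the quotient of two smoothings. -/
lemma condShift_ae_eq (Z W : S.L2G) : S.condShift Z W =ᵐ[P] fun ω =>
    smoothing P (Z : Lp ℝ 2 P) (W : Lp ℝ 2 P) (S.shift Z ω) /
      smoothing P (Z : Lp ℝ 2 P) (fun _ => 1) (S.shift Z ω) := by
  have hle : MeasurableSpace.comap (S.shift Z) inferInstance ≤ (inferInstance : MeasurableSpace Ω) :=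
    (S.measurable_shift Z).comap_le
  have hZ := (S.measurable_coe Z).aestronglyMeasurable (μ := P)
  have hWi : Integrable ((W : Lp ℝ 2 P) : Ω → ℝ) P := integrable_coe _
  set p := smoothing P (Z : Lp ℝ 2 P) (fun _ => 1) with hp
  set r := smoothing P (Z : Lp ℝ 2 P) (W : Lp ℝ 2 P) with hr
  have hpc : Continuous p := continuous_smoothing hZ (integrable_const _)
  have hrc : Continuous r := continuous_smoothing hZ hWi
  have hp0 : ∀ x, 0 < p x := smoothing_one_pos hZ
  have hgm : Measurable (fun x => r x / p x) := hrc.measurable.div hpc.measurable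
  have hlaw := S.map_shift_eq_withDensity Z
  rw [← hp] at hlaw
  have hmul : ∀ x, (ENNReal.ofReal (p x)).toReal • (r x / p x) = r x := by
    intro x
    rw [ENNReal.toReal_ofReal (hp0 x).le, smul_eq_mul, mul_div_cancel₀ _ (hp0 x).ne']
  have hgi : Integrable (fun x => r x / p x) (P.map (S.shift Z)) := by
    rw [hlaw, integrable_withDensity_iff_integrable_smul' (by fun_prop)
      (Eventually.of_forall fun x => ENNReal.ofReal_lt_top)]
    simp_rw [hmul]
    exact integrable_smoothing (S.measurable_coe Z) hWi
  have hgi' : Integrable (fun ω => r (S.shift Z ω) / p (S.shift Z ω)) P :=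
    hgi.comp_measurable (S.measurable_shift Z)
  refine (ae_eq_condExp_of_forall_setIntegral_eq hle hWi (fun _ _ _ => hgi'.integrableOn) ?_ ?_).symm
  -- Both integrals over `{Z + Γ ∈ B}` equal `∫ x in B, r x`: for `W` by definition of `r`, for the
  -- quotient because the density `p` cancels.
  · rintro s ⟨B, hB, rfl⟩ -
    have e1 := setIntegral_preimage_add (S.measurable_coe Z) hWi (S.measurable_coe W)
      S.measurable_Γ S.map_Γ (S.indepFun_prodMk Z W) hB
    have e2 : ∫ ω in S.shift Z ⁻¹' B, r (S.shift Z ω) / p (S.shift Z ω) ∂P =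
        ∫ x in B, r x / p x ∂(P.map (S.shift Z)) :=
      (setIntegral_map hB hgi.1 (S.measurable_shift Z).aemeasurable).symm
    rw [e2, hlaw, setIntegral_withDensity_eq_setIntegral_toReal_smul (by fun_prop)
      (Eventually.of_forall fun x => ENNReal.ofReal_lt_top) _ hB]
    simp_rw [hmul]
    exact e1.symm
  · exact (hgm.comp (comap_measurable (S.shift Z))).stronglyMeasurable.aestronglyMeasurable

end Setting

lemma IsLipschitzQuantile.map_comp {ν : Measure ℝ} {Q : ℝ → ℝ} {K : ℝ≥0} {M : ℝ}
    (hQ : IsLipschitzQuantile ν Q K M) {α : Type*} [MeasurableSpace α] {ρ : Measure α} {U : α → ℝ}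
    (hU : Measurable U) (h : ρ.map U = volume.restrict (Icc 0 1)) :
    ρ.map (fun x => Q (U x)) = ν := by
  rw [← hQ.map_eq, ← h, Measure.map_map hQ.monotone.measurable hU]
  rfl

/-! ### The Brenier map, the optimizer, and the gradient of `V`. -/

namespace Setting

variable {Ω : Type*} [MeasurableSpace Ω] {P : Measure Ω} {μ ν : Measure ℝ}
  [IsProbabilityMeasure P] (S : Setting P μ) {Q : ℝ → ℝ} {K : ℝ≥0} {M : ℝ}

/-- The Brenier map from the law of `Z + Γ` to the measure with quantile function `Q`. -/
noncomputable def brenierMap (Q : ℝ → ℝ) (Z : S.L2G) (x : ℝ) : ℝ :=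
  Q (shiftCDF P (Z : Lp ℝ 2 P) x)

lemma continuous_brenierMap (hQ : IsLipschitzQuantile ν Q K M) (Z : S.L2G) :
    Continuous (S.brenierMap Q Z) :=
  hQ.lipschitz.continuous.comp (continuous_shiftCDF (integrable_coe _))

lemma monotone_brenierMap (hQ : IsLipschitzQuantile ν Q K M) (Z : S.L2G) :
    Monotone (S.brenierMap Q Z) :=
  hQ.monotone.comp (strictMono_shiftCDF (integrable_coe _)).monotone

lemma injective_brenierMap (hQ : IsLipschitzQuantile ν Q K M) (Z : S.L2G) :
    Function.Injective (S.brenierMap Q Z) := by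
  have hi := integrable_coe (Z : Lp ℝ 2 P)
  intro x y hxy
  exact (strictMono_shiftCDF hi).injective (hQ.injOn (Ioo_subset_Icc_self (shiftCDF_mem_Ioo hi x))
    (Ioo_subset_Icc_self (shiftCDF_mem_Ioo hi y)) hxy)

lemma map_brenierMap (hQ : IsLipschitzQuantile ν Q K M) (Z : S.L2G) :
    (P.map (S.shift Z)).map (S.brenierMap Q Z) = ν :=
  hQ.map_comp (continuous_shiftCDF (integrable_coe _)).measurable (S.map_shift_shiftCDF Z)

lemma map_brenierMap_shift (hQ : IsLipschitzQuantile ν Q K M) (Z : S.L2G) :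
    P.map (fun ω => S.brenierMap Q Z (S.shift Z ω)) = ν := by
  rw [← S.map_brenierMap hQ Z, Measure.map_map (S.continuous_brenierMap hQ Z).measurable
    (S.measurable_shift Z)]
  rfl

lemma exists_isBrenierPotential (hQ : IsLipschitzQuantile ν Q K M) (Z : S.L2G) :
    ∃ v, IsBrenierPotential v (P.map (S.shift Z)) ν := by
  have hc := S.continuous_brenierMap hQ Z
  have hd : ∀ x, HasDerivAt (fun x => ∫ t in (0 : ℝ)..x, S.brenierMap Q Z t)
      (S.brenierMap Q Z x) x := fun x =>
    intervalIntegral.integral_hasDerivAt_right (hc.intervalIntegrable _ _)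
      (hc.stronglyMeasurableAtFilter _ _) hc.continuousAt
  have hd' : deriv (fun x => ∫ t in (0 : ℝ)..x, S.brenierMap Q Z t) = S.brenierMap Q Z :=
    funext fun x => (hd x).deriv
  refine ⟨fun x => ∫ t in (0 : ℝ)..x, S.brenierMap Q Z t, ?_, ?_⟩
  · refine Monotone.convexOn_univ_of_deriv (fun x => (hd x).differentiableAt) ?_
    rw [hd']
    exact S.monotone_brenierMap hQ Z
  · rw [hd', S.map_brenierMap hQ Z]

lemma map_shift_absolutelyContinuous (Z : S.L2G) : P.map (S.shift Z) ≪ volume := by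
  rw [S.map_shift_eq_withDensity Z]
  exact withDensity_absolutelyContinuous _ _

/-- The derivative of a Brenier potential exists everywhere, and is the monotone
rearrangement. -/
lemma hasDerivAt_of_isBrenierPotential [IsProbabilityMeasure ν]
    (hQ : IsLipschitzQuantile ν Q K M) {Z : S.L2G} {v : ℝ → ℝ}
    (hv : IsBrenierPotential v (P.map (S.shift Z)) ν) (x : ℝ) :
    HasDerivAt v (S.brenierMap Q Z x) x := by
  refine hasDerivAt_of_forall_differentiableAt hv.1 (S.continuous_brenierMap hQ Z)
    (fun x hx => ?_) x
  have hi := integrable_coe (Z : Lp ℝ 2 P)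
  set ρ := P.map (S.shift Z) with hρ
  have hD : ∀ᵐ y ∂ρ, DifferentiableAt ℝ v y := by
    refine (S.map_shift_absolutelyContinuous Z).ae_le ?_
    exact (countable_not_differentiableAt hv.1).measure_zero _
  have hmono : ∀ y z, DifferentiableAt ℝ v y → DifferentiableAt ℝ v z → y ≤ z →
      deriv v y ≤ deriv v z := by
    intro y z hy hz hyz
    rcases hyz.eq_or_lt with rfl | hlt
    · exact le_rfl
    · exact (hv.1.deriv_le_slope (mem_univ _) (mem_univ _) hlt hy).trans
        (hv.1.slope_le_of_hasDerivAt (mem_univ _) (mem_univ _) hlt hz.hasDerivAt)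
  have hgm := measurable_deriv v
  -- Monotonicity of `deriv v` gives `{y ≤ x} ⊆ {v' y ≤ v' x}` and `{v' y < v' x} ⊆ {y ≤ x}` up to
  -- null sets. As `ν` has no atoms, the outer events have equal mass; applying `Q` then identifies
  -- `v' x`.
  have hcdf : cdf ρ x = cdf ν (deriv v x) := by
    have hna : ν (Iic (deriv v x)) = ν (Iio (deriv v x)) := by
      refine le_antisymm ?_ (measure_mono Iio_subset_Iic_self)
      rw [← Iio_union_right]
      refine (measure_union_le _ _).trans ?_
      rw [hQ.measure_singleton, add_zero]
    have h1 : ρ (Iic x) ≤ ν (Iic (deriv v x)) := by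
      rw [← hv.2, Measure.map_apply hgm measurableSet_Iic]
      refine measure_mono_ae ?_
      filter_upwards [hD] with y hy hyx using hmono y x hy hx hyx
    have h2 : ν (Iic (deriv v x)) ≤ ρ (Iic x) := by
      rw [hna, ← hv.2, Measure.map_apply hgm measurableSet_Iio]
      refine measure_mono_ae ?_
      filter_upwards [hD] with y hy hyx
      by_contra hlt
      exact absurd (hmono x y hx hy (not_le.1 hlt).le) (not_le.2 hyx)
    rw [cdf_eq_real, cdf_eq_real, measureReal_def, measureReal_def, le_antisymm h1 h2]
  have hcdf' := hcdf
  rw [S.cdf_map_shift Z] at hcdf'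
  have hmem := shiftCDF_mem_Ioo hi x
  rw [hcdf'] at hmem
  rw [brenierMap, hcdf', hQ.apply_cdf _ hmem.1 hmem.2]

omit [IsProbabilityMeasure P] in
lemma memLp_shift (Z : S.L2G) : MemLp (S.shift Z) 2 P := by
  refine (Lp.memLp (Z : Lp ℝ 2 P)).add ?_
  have h : MemLp (id : ℝ → ℝ) 2 (P.map S.Γ) := by
    rw [S.map_Γ]; exact memLp_id_gaussianReal 2
  exact h.comp_of_map S.measurable_Γ.aemeasurable

lemma memLp_brenierMap_shift (hQ : IsLipschitzQuantile ν Q K M) (Z : S.L2G) :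
    MemLp (fun ω => S.brenierMap Q Z (S.shift Z ω)) 2 P :=
  MemLp.of_bound ((S.continuous_brenierMap hQ Z).measurable.comp
    (S.measurable_shift Z)).aestronglyMeasurable M (Eventually.of_forall fun _ => hQ.abs_le _)

/-- The Brenier map maximizes the correlation with `Z + Γ`. -/
lemma integral_shift_mul_le [IsProbabilityMeasure ν] (hQ : IsLipschitzQuantile ν Q K M) (Z : S.L2G)
    {Y : Ω → ℝ} (hY : MemLp Y 2 P) (hmap : P.map Y = ν) :
    ∫ ω, S.shift Z ω * Y ω ∂P ≤ ∫ ω, S.shift Z ω * S.brenierMap Q Z (S.shift Z ω) ∂P := by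
  obtain ⟨v, hv⟩ := S.exists_isBrenierPotential hQ Z
  have hd := S.hasDerivAt_of_isBrenierPotential hQ hv
  set T := S.brenierMap Q Z with hT
  have hTc : Continuous T := S.continuous_brenierMap hQ Z
  have hTe : MeasurableEmbedding T := hTc.measurableEmbedding (S.injective_brenierMap hQ Z)
  have hvc : Continuous v := continuous_iff_continuousAt.2 fun x => (hd x).continuousAt
  -- On the range of `T`, `w` is the convex conjugate of `v`; it is well defined there because `T`
  -- is injective. The proof is Kantorovich duality with the pair `(v, w)`.
  obtain ⟨w, hwm, hw⟩ := hTe.exists_measurable_extend (g := fun x => x * T x - v x)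
    ((measurable_id.mul hTc.measurable).sub hvc.measurable) (fun _ => ⟨0⟩)
  have hshift := S.memLp_shift Z
  have hTs : MemLp (fun ω => T (S.shift Z ω)) 2 P := S.memLp_brenierMap_shift hQ Z
  have hTmap : P.map (fun ω => T (S.shift Z ω)) = ν := S.map_brenierMap_shift hQ Z
  have hvi : Integrable (fun ω => v (S.shift Z ω)) P := by
    have hlip : LipschitzWith M.toNNReal v :=
      lipschitzWith_of_nnnorm_deriv_le (fun x => (hd x).differentiableAt) fun x => by
        rw [(hd x).deriv, ← NNReal.coe_le_coe, coe_nnnorm]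
        exact (hQ.abs_le _).trans (Real.le_coe_toNNReal M)
    refine ((hshift.integrable (by norm_num)).abs.const_mul (M.toNNReal : ℝ)).add
      (integrable_const |v 0|) |>.mono (hvc.measurable.comp
      (S.measurable_shift Z)).aestronglyMeasurable (Eventually.of_forall fun ω => ?_)
    have h1 := hlip.dist_le_mul (S.shift Z ω) 0
    rw [Real.dist_eq, Real.dist_eq, sub_zero] at h1
    have h2 := abs_sub_abs_le_abs_sub (v (S.shift Z ω)) (v 0)
    rw [Real.norm_eq_abs]
    refine le_trans ?_ (le_abs_self _)
    simp only [Pi.add_apply]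
    linarith
  have hwT : ∀ x, w (T x) = x * T x - v x := fun x => congrFun hw x
  have hwi : Integrable (fun ω => w (T (S.shift Z ω))) P := by
    simp_rw [hwT]
    exact (hshift.integrable_mul hTs).sub hvi
  have hwν : Integrable w ν := by
    rw [← hTmap, integrable_map_measure hwm.aestronglyMeasurable hTs.1.aemeasurable]
    exact hwi
  have hYm : AEMeasurable Y P := hY.1.aemeasurable
  have hwY : Integrable (fun ω => w (Y ω)) P := by
    have := hwν
    rw [← hmap, integrable_map_measure hwm.aestronglyMeasurable hYm] at this
    exact this
  -- The dual value depends on `Y` only through its law `ν`, so it is the same for every competitor.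
  have hwint : ∫ ω, w (Y ω) ∂P = ∫ ω, w (T (S.shift Z ω)) ∂P := by
    rw [← integral_map hYm hwm.aestronglyMeasurable, hmap, ← hTmap,
      integral_map hTs.1.aemeasurable hwm.aestronglyMeasurable]
  have hrange : ∀ᵐ ω ∂P, Y ω ∈ range T := by
    refine ae_of_ae_map hYm (p := fun y => y ∈ range T) ?_
    rw [hmap, ← hTmap]
    refine (ae_map_iff hTs.1.aemeasurable hTe.measurableSet_range).2 ?_
    exact Eventually.of_forall fun ω => mem_range_self _
  -- Young's inequality `s y ≤ v s + w y` for `y` in the range of `T`, with equality at `y = T s`.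
  calc ∫ ω, S.shift Z ω * Y ω ∂P ≤ ∫ ω, (v (S.shift Z ω) + w (Y ω)) ∂P := by
        refine integral_mono_ae (hshift.integrable_mul hY) (hvi.add hwY) ?_
        filter_upwards [hrange] with ω hω
        obtain ⟨x, hx⟩ := hω
        have := add_mul_le_of_hasDerivAt hv.1 (hd x) (S.shift Z ω)
        simp only [← hx, hwT]
        linarith
    _ = ∫ ω, (v (S.shift Z ω) + w (T (S.shift Z ω))) ∂P := by
        rw [integral_add hvi hwY, integral_add hvi hwi, hwint]
    _ = _ := by
        simp_rw [hwT]
        refine integral_congr_ae (Eventually.of_forall fun ω => ?_)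
        simp only
        ring

/-- The optimal `Y` in the definition of `V(Z)`, as an element of `L²`. -/
noncomputable def optimizer (hQ : IsLipschitzQuantile ν Q K M) (Z : S.L2G) : Lp ℝ 2 P :=
  (S.memLp_brenierMap_shift hQ Z).toLp

lemma coeFn_optimizer (hQ : IsLipschitzQuantile ν Q K M) (Z : S.L2G) :
    S.optimizer hQ Z =ᵐ[P] fun ω => S.brenierMap Q Z (S.shift Z ω) := MemLp.coeFn_toLp _

omit [IsProbabilityMeasure P] in
lemma memLp_X (hμ : MemLp (fun x : ℝ => x) 2 μ) : MemLp S.X 2 P := by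
  rw [← S.map_X] at hμ
  exact hμ.comp_of_map S.measurable_X.aemeasurable

/-- The factor `2` arises because `|g|` and the constant `E|g|` each have norm at most `‖g‖`. -/
lemma norm_le_of_ae_le_add_integral {f : Lp ℝ 2 P} (g : Lp ℝ 2 P) {c : ℝ} (hc : 0 ≤ c)
    (h : ∀ᵐ ω ∂P, |f ω| ≤ c * (|g ω| + ∫ ω', |g ω'| ∂P)) : ‖f‖ ≤ 2 * c * ‖g‖ := by
  have hm : MemLp (fun ω => c * (|g ω| + ∫ ω', |g ω'| ∂P)) 2 P :=
    ((Lp.memLp g).norm.add (memLp_const _)).const_mul c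
  have hi : 0 ≤ ∫ ω', |g ω'| ∂P := integral_nonneg fun _ => abs_nonneg _
  have hle := integral_abs_le_norm g
  have hcn : ‖(memLp_const (p := 2) (μ := P) (∫ ω', |g ω'| ∂P)).toLp‖ ≤ ‖g‖ := by
    rw [Lp.norm_toLp, eLpNorm_const _ (by norm_num) (IsProbabilityMeasure.ne_zero P)]
    simpa [abs_of_nonneg hi] using hle
  have habs : ‖(Lp.memLp g).norm.toLp‖ = ‖g‖ := by
    rw [Lp.norm_toLp, eLpNorm_norm, Lp.norm_def]
  have h2 : ‖f‖ ≤ ‖c • ((Lp.memLp g).norm.toLp +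
      (memLp_const (p := 2) (μ := P) (∫ ω', |g ω'| ∂P)).toLp)‖ := by
    refine Lp.norm_le_norm_of_ae_le ?_
    filter_upwards [h, Lp.coeFn_smul c ((Lp.memLp g).norm.toLp +
      (memLp_const (p := 2) (μ := P) (∫ ω', |g ω'| ∂P)).toLp),
      Lp.coeFn_add (Lp.memLp g).norm.toLp (memLp_const (p := 2) (μ := P) (∫ ω', |g ω'| ∂P)).toLp,
      (Lp.memLp g).norm.coeFn_toLp, (memLp_const (p := 2) (μ := P) (∫ ω', |g ω'| ∂P)).coeFn_toLp]
      with ω h1 h2 h3 h4 h5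
    rw [h2, Pi.smul_apply, h3, Pi.add_apply, h4, h5]
    simp only [Real.norm_eq_abs, smul_eq_mul]
    exact h1.trans (le_abs_self _)
  refine h2.trans ((norm_smul_le _ _).trans ?_)
  rw [Real.norm_eq_abs, abs_of_nonneg hc]
  have h3 := (norm_add_le (Lp.memLp g).norm.toLp
    (memLp_const (p := 2) (μ := P) (∫ ω', |g ω'| ∂P)).toLp).trans (add_le_add habs.le hcn)
  calc _ ≤ c * (‖g‖ + ‖g‖) := by gcongr
    _ = 2 * c * ‖g‖ := by ring

omit [IsProbabilityMeasure P] in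
lemma coeFn_sub (Z Z' : S.L2G) : (((Z - Z' : S.L2G) : Lp ℝ 2 P) : Ω → ℝ) =ᵐ[P]
    fun ω => (Z : Lp ℝ 2 P) ω - (Z' : Lp ℝ 2 P) ω := Lp.coeFn_sub _ _

lemma lipschitzWith_optimizer (hQ : IsLipschitzQuantile ν Q K M) :
    LipschitzWith (2 * K) (S.optimizer hQ) := by
  refine LipschitzWith.of_dist_le_mul fun Z Z' => ?_
  rw [dist_eq_norm, dist_eq_norm]
  refine norm_le_of_ae_le_add_integral ((Z - Z' : S.L2G) : Lp ℝ 2 P) K.2 ?_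
  have hint : ∫ ω', |((Z - Z' : S.L2G) : Lp ℝ 2 P) ω'| ∂P =
      ∫ ω', |(Z : Lp ℝ 2 P) ω' - (Z' : Lp ℝ 2 P) ω'| ∂P :=
    integral_congr_ae (by filter_upwards [S.coeFn_sub Z Z'] with ω h using by rw [h])
  filter_upwards [S.coeFn_optimizer hQ Z, S.coeFn_optimizer hQ Z', S.coeFn_sub Z Z',
    Lp.coeFn_sub (S.optimizer hQ Z) (S.optimizer hQ Z')] with ω h1 h2 h3 h4
  rw [h4, Pi.sub_apply, h1, h2, hint, h3]
  have h5 := hQ.lipschitz.dist_le_mul (S.unif Z ω) (S.unif Z' ω)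
  have h6 := abs_shiftCDF_sub_le (integrable_coe (Z : Lp ℝ 2 P)) (integrable_coe (Z' : Lp ℝ 2 P))
    (S.shift Z ω) (S.shift Z' ω)
  have h7 : S.shift Z ω - S.shift Z' ω = (Z : Lp ℝ 2 P) ω - (Z' : Lp ℝ 2 P) ω := by
    simp [shift]
  rw [h7] at h6
  exact h5.trans (mul_le_mul_of_nonneg_left h6 K.2)

lemma integral_shift_mul_sub_le [IsProbabilityMeasure ν] (hQ : IsLipschitzQuantile ν Q K M)
    (hμ : MemLp (fun x : ℝ => x) 2 μ) (Z : S.L2G) {Y : Ω → ℝ} (hY : MemLp Y 2 P)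
    (hmap : P.map Y = ν) :
    ∫ ω, (S.shift Z ω * Y ω - (Z : Lp ℝ 2 P) ω * S.X ω) ∂P ≤
      ∫ ω, (S.shift Z ω * S.optimizer hQ Z ω - (Z : Lp ℝ 2 P) ω * S.X ω) ∂P := by
  have hZX : Integrable (fun ω => (Z : Lp ℝ 2 P) ω * S.X ω) P :=
    (Lp.memLp (Z : Lp ℝ 2 P)).integrable_mul (S.memLp_X hμ)
  have h1 := S.integral_shift_mul_le hQ Z hY hmap
  have e2 : ∫ ω, S.shift Z ω * S.optimizer hQ Z ω ∂P =
      ∫ ω, S.shift Z ω * S.brenierMap Q Z (S.shift Z ω) ∂P := by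
    refine integral_congr_ae ?_
    filter_upwards [S.coeFn_optimizer hQ Z] with ω h2
    rw [h2]
  have e1 := integral_sub ((S.memLp_shift Z).integrable_mul hY) hZX
  have e3 := integral_sub ((S.memLp_shift Z).integrable_mul (Lp.memLp (S.optimizer hQ Z))) hZX
  rw [← e2] at h1
  exact e1.le.trans ((sub_le_sub_right h1 _).trans e3.ge)

lemma isGreatest_V [IsProbabilityMeasure ν] (hQ : IsLipschitzQuantile ν Q K M)
    (hμ : MemLp (fun x : ℝ => x) 2 μ) (Z : S.L2G) :
    IsGreatest {r : ℝ | ∃ Y : Ω → ℝ, Measurable[S.H] Y ∧ MemLp Y 2 P ∧ P.map Y = ν ∧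
      r = ∫ ω, (((Z : Lp ℝ 2 P) ω + S.Γ ω) * Y ω - (Z : Lp ℝ 2 P) ω * S.X ω) ∂P}
    (∫ ω, (S.shift Z ω * S.optimizer hQ Z ω - (Z : Lp ℝ 2 P) ω * S.X ω) ∂P) := by
  have hT := S.memLp_brenierMap_shift hQ Z
  have hTc := S.continuous_brenierMap hQ Z
  constructor
  · obtain ⟨z, hz, hZ⟩ := S.exists_ae_eq_comp Z
    -- The chosen representative of `Z` need not be `σ(X)`-measurable; replacing it by `z ∘ X` gives
    -- an admissible `Y`.
    have hae : (fun ω => S.brenierMap Q Z (z (S.X ω) + S.Γ ω)) =ᵐ[P]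
        fun ω => S.brenierMap Q Z (S.shift Z ω) := by
      filter_upwards [hZ] with ω h
      rw [shift, h, Function.comp]
    refine ⟨fun ω => S.brenierMap Q Z (z (S.X ω) + S.Γ ω), ?_, (memLp_congr_ae hae).2 hT, ?_, ?_⟩
    · exact (hTc.measurable.comp ((hz.comp measurable_fst).add measurable_snd)).comp
        (comap_measurable fun ω => (S.X ω, S.Γ ω))
    · rw [Measure.map_congr hae, S.map_brenierMap_shift hQ Z]
    · refine integral_congr_ae ?_
      filter_upwards [hae, S.coeFn_optimizer hQ Z] with ω h1 h2
      rw [h2, h1]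
      rfl
  · rintro r ⟨Y, -, hY, hmap, rfl⟩
    exact S.integral_shift_mul_sub_le hQ hμ Z hY hmap

lemma V_eq [IsProbabilityMeasure ν] (hQ : IsLipschitzQuantile ν Q K M)
    (hμ : MemLp (fun x : ℝ => x) 2 μ) (Z : S.L2G) :
    S.V ν Z = ∫ ω, (S.shift Z ω * S.optimizer hQ Z ω - (Z : Lp ℝ 2 P) ω * S.X ω) ∂P :=
  (S.isGreatest_V hQ hμ Z).csSup_eq

lemma map_optimizer (hQ : IsLipschitzQuantile ν Q K M) (Z : S.L2G) :
    P.map (S.optimizer hQ Z) = ν := by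
  rw [Measure.map_congr (S.coeFn_optimizer hQ Z), S.map_brenierMap_shift hQ Z]

omit [IsProbabilityMeasure P] in
lemma G_le : S.G ≤ (inferInstance : MeasurableSpace Ω) := S.measurable_X.comap_le

omit [IsProbabilityMeasure P] in
lemma inner_condExpL2 (f : Lp ℝ 2 P) (W : S.L2G) :
    inner ℝ (condExpL2 ℝ ℝ S.G_le f) W = inner ℝ f (W : Lp ℝ 2 P) :=
  Submodule.inner_orthogonalProjectionOnto_eq_of_mem_right W f

/-- The gradient of `V` at `Z`. -/
noncomputable def gradV (hQ : IsLipschitzQuantile ν Q K M) (hμ : MemLp (fun x : ℝ => x) 2 μ)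
    (Z : S.L2G) : S.L2G := condExpL2 ℝ ℝ S.G_le (S.optimizer hQ Z - (S.memLp_X hμ).toLp)

/-- The optimizer at `Z` is a competitor at `Z'`, and the objective is affine in `Z`. Since `Z' - Z`
is in `L²(𝒢)`, projecting the subgradient leaves the pairing unchanged. -/
lemma V_add_inner_le [IsProbabilityMeasure ν] (hQ : IsLipschitzQuantile ν Q K M)
    (hμ : MemLp (fun x : ℝ => x) 2 μ) (Z Z' : S.L2G) :
    S.V ν Z + inner ℝ (S.gradV hQ hμ Z) (Z' - Z) ≤ S.V ν Z' := by
  rw [S.V_eq hQ hμ Z']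
  refine le_trans (le_of_eq ?_) (S.integral_shift_mul_sub_le hQ hμ Z'
    (Lp.memLp (S.optimizer hQ Z)) (S.map_optimizer hQ Z))
  have hX := S.memLp_X hμ
  have hY := Lp.memLp (S.optimizer hQ Z)
  have hi : Integrable (fun ω => S.shift Z ω * S.optimizer hQ Z ω - (Z : Lp ℝ 2 P) ω * S.X ω) P :=
    ((S.memLp_shift Z).integrable_mul hY).sub ((Lp.memLp (Z : Lp ℝ 2 P)).integrable_mul hX)
  rw [gradV, inner_condExpL2, S.V_eq hQ hμ, L2.inner_def, ← integral_add hi (L2.integrable_inner _ _)]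
  refine integral_congr_ae ?_
  filter_upwards [S.coeFn_sub Z' Z, Lp.coeFn_sub (S.optimizer hQ Z) hX.toLp, hX.coeFn_toLp]
    with ω h1 h2 h3
  rw [h1, h2, Pi.sub_apply, h3]
  simp only [shift, RCLike.inner_apply, conj_trivial]
  ring

lemma hasGradientAt_V [IsProbabilityMeasure ν] (hQ : IsLipschitzQuantile ν Q K M)
    (hμ : MemLp (fun x : ℝ => x) 2 μ) (Z : S.L2G) :
    HasGradientAt (S.V ν) (S.gradV hQ hμ Z) Z :=
  hasGradientAt_of_forall_inner_le (S.V_add_inner_le hQ hμ)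
    ((condExpL2 ℝ ℝ S.G_le).continuous.comp
      ((S.lipschitzWith_optimizer hQ).continuous.sub continuous_const)) Z

/-! ### Differentiating the optimizer in `Z`. -/

/-- The directional derivative of the optimizer at `Z` in direction `W`. -/
noncomputable def sensitivity (Q : ℝ → ℝ) (Z W : S.L2G) (ω : Ω) : ℝ :=
  deriv Q (S.unif Z ω) *
    ((W : Lp ℝ 2 P) ω * smoothing P (Z : Lp ℝ 2 P) (fun _ => 1) (S.shift Z ω) -
      smoothing P (Z : Lp ℝ 2 P) (W : Lp ℝ 2 P) (S.shift Z ω))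

lemma measurable_sensitivity (Z W : S.L2G) :
    Measurable (S.sensitivity Q Z W) := by
  have hZ := (S.measurable_coe Z).aestronglyMeasurable (μ := P)
  have h1 := (continuous_smoothing hZ (integrable_const (1 : ℝ))).measurable.comp
    (S.measurable_shift Z)
  have h2 := (continuous_smoothing hZ (integrable_coe (W : Lp ℝ 2 P))).measurable.comp
    (S.measurable_shift Z)
  exact ((measurable_deriv Q).comp (S.measurable_unif Z)).mul
    (((S.measurable_coe W).mul h1).sub h2)

lemma smoothing_one_le_one (Z : Ω → ℝ) (x : ℝ) : |smoothing P Z (fun _ => 1) x| ≤ 1 := by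
  simpa using abs_smoothing_le (P := P) (Z := Z) x (integrable_const (1 : ℝ))

lemma abs_sensitivity_le (hQ : IsLipschitzQuantile ν Q K M) (Z W : S.L2G) (ω : Ω) :
    |S.sensitivity Q Z W ω| ≤ K * (|(W : Lp ℝ 2 P) ω| + ∫ ω', |(W : Lp ℝ 2 P) ω'| ∂P) := by
  rw [sensitivity, abs_mul]
  refine mul_le_mul (norm_deriv_le_of_lipschitz hQ.lipschitz) ?_ (abs_nonneg _) K.2
  refine (abs_sub _ _).trans (add_le_add ?_ (abs_smoothing_le _ (integrable_coe _)))
  rw [abs_mul]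
  exact mul_le_of_le_one_right (abs_nonneg _) (smoothing_one_le_one _ _)

lemma memLp_bound (c : ℝ) (W : Lp ℝ 2 P) :
    MemLp (fun ω => c * (|W ω| + ∫ ω', |W ω'| ∂P)) 2 P :=
  ((Lp.memLp W).norm.add (memLp_const _)).const_mul c

lemma memLp_sensitivity (hQ : IsLipschitzQuantile ν Q K M) (Z W : S.L2G) :
    MemLp (S.sensitivity Q Z W) 2 P := by
  refine (memLp_bound K (W : Lp ℝ 2 P)).mono (S.measurable_sensitivity Z W).aestronglyMeasurable
    (Eventually.of_forall fun ω => ?_)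
  exact (S.abs_sensitivity_le hQ Z W ω).trans (le_abs_self _)

/-- The directional derivative of the optimizer, as an element of `L²`. -/
noncomputable def sensitivityLp (hQ : IsLipschitzQuantile ν Q K M) (Z W : S.L2G) : Lp ℝ 2 P :=
  (S.memLp_sensitivity hQ Z W).toLp

lemma coeFn_sensitivityLp (hQ : IsLipschitzQuantile ν Q K M) (Z W : S.L2G) :
    S.sensitivityLp hQ Z W =ᵐ[P] S.sensitivity Q Z W := MemLp.coeFn_toLp _

lemma sensitivity_sub (Z W W' : S.L2G) : S.sensitivity Q Z (W - W') =ᵐ[P]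
    fun ω => S.sensitivity Q Z W ω - S.sensitivity Q Z W' ω := by
  have hZ := (S.measurable_coe Z).aestronglyMeasurable (μ := P)
  have h1 : ∀ x, smoothing P (Z : Lp ℝ 2 P) ((W - W' : S.L2G) : Lp ℝ 2 P) x =
      smoothing P (Z : Lp ℝ 2 P) (W : Lp ℝ 2 P) x -
        smoothing P (Z : Lp ℝ 2 P) (W' : Lp ℝ 2 P) x := by
    intro x
    rw [smoothing_congr (ae_eq_refl _) (S.coeFn_sub W W') x]
    unfold smoothing
    rw [← integral_sub (integrable_stdPDF_sub_mul hZ (integrable_coe _) x)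
      (integrable_stdPDF_sub_mul hZ (integrable_coe _) x)]
    simp_rw [mul_sub]
  filter_upwards [S.coeFn_sub W W'] with ω h
  simp only [sensitivity, h, h1]
  ring

lemma lipschitzWith_sensitivityLp (hQ : IsLipschitzQuantile ν Q K M) (Z : S.L2G) :
    LipschitzWith (2 * K) (S.sensitivityLp hQ Z) := by
  refine LipschitzWith.of_dist_le_mul fun W W' => ?_
  rw [dist_eq_norm, dist_eq_norm]
  refine norm_le_of_ae_le_add_integral ((W - W' : S.L2G) : Lp ℝ 2 P) K.2 ?_
  filter_upwards [S.coeFn_sensitivityLp hQ Z W, S.coeFn_sensitivityLp hQ Z W',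
    Lp.coeFn_sub (S.sensitivityLp hQ Z W) (S.sensitivityLp hQ Z W'),
    S.sensitivity_sub (Q := Q) Z W W'] with ω h1 h2 h3 h4
  rw [h3, Pi.sub_apply, h1, h2, ← h4]
  exact S.abs_sensitivity_le hQ Z (W - W') ω

/-- The null set where the monotone `Q` is not differentiable is avoided almost surely by a uniform
variable. -/
lemma ae_differentiableAt_unif (hQ : IsLipschitzQuantile ν Q K M) (Z : S.L2G) :
    ∀ᵐ ω ∂P, DifferentiableAt ℝ Q (S.unif Z ω) := by
  refine ae_of_ae_map (S.measurable_unif Z).aemeasurable (p := fun u => DifferentiableAt ℝ Q u) ?_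
  rw [S.map_unif]
  exact ae_restrict_of_ae hQ.monotone.ae_differentiableAt

lemma hasDerivAt_optimizer_line (hQ : IsLipschitzQuantile ν Q K M) (Z W : S.L2G) :
    HasDerivAt (fun h : ℝ => S.optimizer hQ (Z + h • W)) (S.sensitivityLp hQ Z W) 0 := by
  have hZi := integrable_coe (Z : Lp ℝ 2 P)
  have hWi := integrable_coe (W : Lp ℝ 2 P)
  have hcoe : ∀ h : ℝ, (((Z + h • W : S.L2G) : Lp ℝ 2 P) : Ω → ℝ) =ᵐ[P]
      fun ω => (Z : Lp ℝ 2 P) ω + h * (W : Lp ℝ 2 P) ω := by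
    intro h
    have e : ((Z + h • W : S.L2G) : Lp ℝ 2 P) = (Z : Lp ℝ 2 P) + h • (W : Lp ℝ 2 P) := rfl
    rw [e]
    filter_upwards [Lp.coeFn_add (Z : Lp ℝ 2 P) (h • (W : Lp ℝ 2 P)),
      Lp.coeFn_smul h (W : Lp ℝ 2 P)] with ω h1 h2
    rw [h1, Pi.add_apply, h2, Pi.smul_apply, smul_eq_mul]
  -- A version of `unif (Z + h • W)` defined for every `h` and `ω`. For fixed `ω` it can be
  -- differentiated in `h`, with no exceptional set depending on `h`.
  set u : ℝ → Ω → ℝ := fun h ω => shiftCDF P (fun ω => (Z : Lp ℝ 2 P) ω + h * (W : Lp ℝ 2 P) ω)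
    (S.shift Z ω + h * (W : Lp ℝ 2 P) ω) with hu
  have hu0 : ∀ ω, u 0 ω = S.unif Z ω := by
    intro ω; simp [hu, unif]
  have hopt : ∀ h, S.optimizer hQ (Z + h • W) =ᵐ[P] fun ω => Q (u h ω) := by
    intro h
    filter_upwards [S.coeFn_optimizer hQ (Z + h • W), hcoe h] with ω h1 h2
    rw [h1, brenierMap, shiftCDF_congr (hcoe h), shift, h2]
    simp only [hu, shift]
    congr 2
    ring
  rw [hasDerivAt_iff_tendsto_slope_zero]
  refine tendsto_Lp_two_of_dominated (memLp_bound (K : ℝ) (W : Lp ℝ 2 P))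
    (f' := fun h ω => h⁻¹ * (Q (u h ω) - Q (u 0 ω))) (g' := S.sensitivity Q Z W) ?_
    (S.coeFn_sensitivityLp hQ Z W) ?_ ?_
  · intro h
    rw [zero_add]
    filter_upwards [hopt h, hopt 0, Lp.coeFn_smul h⁻¹
      (S.optimizer hQ (Z + h • W) - S.optimizer hQ (Z + (0 : ℝ) • W)),
      Lp.coeFn_sub (S.optimizer hQ (Z + h • W)) (S.optimizer hQ (Z + (0 : ℝ) • W))]
      with ω h1 h2 h3 h4
    rw [h3, Pi.smul_apply, h4, Pi.sub_apply, h1, h2, smul_eq_mul]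
  · intro h
    refine Eventually.of_forall fun ω => ?_
    have h1 := hQ.lipschitz.dist_le_mul (u h ω) (u 0 ω)
    rw [Real.dist_eq, Real.dist_eq] at h1
    have h2 : |u h ω - u 0 ω| ≤ |h| * (|(W : Lp ℝ 2 P) ω| + ∫ ω', |(W : Lp ℝ 2 P) ω'| ∂P) := by
      refine (abs_shiftCDF_sub_le (hZi.add (hWi.const_mul h)) (hZi.add (hWi.const_mul 0))
        _ _).trans (le_of_eq ?_)
      simp [abs_mul, integral_const_mul, mul_add]
    rw [abs_mul, abs_inv]
    rcases eq_or_ne h 0 with rfl | hh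
    · simp only [abs_zero, inv_zero, zero_mul]
      have : 0 ≤ ∫ ω', |(W : Lp ℝ 2 P) ω'| ∂P := integral_nonneg fun _ => abs_nonneg _
      have := K.2
      positivity
    · rw [inv_mul_le_iff₀ (abs_pos.2 hh)]
      calc _ ≤ K * |u h ω - u 0 ω| := h1
        _ ≤ K * (|h| * (|(W : Lp ℝ 2 P) ω| + ∫ ω', |(W : Lp ℝ 2 P) ω'| ∂P)) := by gcongr
        _ = _ := by ring
  · filter_upwards [S.ae_differentiableAt_unif hQ Z] with ω hω
    have h1 : HasDerivAt (fun h => u h ω) _ 0 :=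
      hasDerivAt_shiftCDF_line hZi hWi (S.shift Z ω) ((W : Lp ℝ 2 P) ω)
    rw [← hu0] at hω
    have h2 := hω.hasDerivAt.comp (0 : ℝ) h1
    rw [hasDerivAt_iff_tendsto_slope_zero] at h2
    simpa [sensitivity, hu0] using h2

/-- The factor `deriv Q` may be discontinuous, but it is evaluated at variables that are all
uniform, so `tendsto_eLpNorm_comp_of_map_eq` applies. Successive subsequences make every factor
converge almost surely, and dominated convergence concludes. -/
lemma continuous_sensitivityLp_left (hQ : IsLipschitzQuantile ν Q K M) (W : S.L2G) :
    Continuous fun Z => S.sensitivityLp hQ Z W := by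
  have hWi := integrable_coe (W : Lp ℝ 2 P)
  refine continuous_iff_seqContinuous.2 fun z Z hz => ?_
  refine tendsto_of_subseq_tendsto fun ns hns => ?_
  have hsub : Tendsto (fun i => ((z (ns i) : S.L2G) : Lp ℝ 2 P)) atTop (𝓝 (Z : Lp ℝ 2 P)) :=
    (continuous_subtype_val.tendsto Z).comp (hz.comp hns)
  obtain ⟨ms, hms, hae⟩ := exists_subseq_tendsto_ae hsub
  have hshift : ∀ᵐ ω ∂P, Tendsto (fun i => S.shift (z (ns (ms i))) ω) atTop (𝓝 (S.shift Z ω)) := by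
    filter_upwards [hae] with ω h using h.add_const _
  have hL1 : Tendsto (fun i => ∫ ω, |((z (ns (ms i)) : S.L2G) : Lp ℝ 2 P) ω - (Z : Lp ℝ 2 P) ω| ∂P)
      atTop (𝓝 0) := by
    have h1 := tendsto_iff_norm_sub_tendsto_zero.1 (hsub.comp hms.tendsto_atTop)
    refine squeeze_zero (fun i => integral_nonneg fun _ => abs_nonneg _) (fun i => ?_) h1
    refine le_trans (le_of_eq ?_) (integral_abs_le_norm _)
    refine integral_congr_ae ?_
    filter_upwards [Lp.coeFn_sub ((z (ns (ms i)) : S.L2G) : Lp ℝ 2 P) (Z : Lp ℝ 2 P)] with ω h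
    simp only [Function.comp, h, Pi.sub_apply]
  have hunif : ∀ᵐ ω ∂P, Tendsto (fun i => S.unif (z (ns (ms i))) ω) atTop (𝓝 (S.unif Z ω)) := by
    filter_upwards [hshift] with ω h
    rw [tendsto_iff_dist_tendsto_zero]
    have h1 := (tendsto_iff_dist_tendsto_zero.1 h).add hL1
    rw [add_zero] at h1
    exact squeeze_zero (fun i => dist_nonneg)
      (fun i => abs_shiftCDF_sub_le (integrable_coe _) (integrable_coe _) _ _) h1
  have hq : MemLp (deriv Q) 2 (volume.restrict (Icc (0 : ℝ) 1)) :=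
    MemLp.of_bound (measurable_deriv Q).aestronglyMeasurable K
      (Eventually.of_forall fun _ => norm_deriv_le_of_lipschitz hQ.lipschitz)
  have hqlim := tendsto_eLpNorm_comp_of_map_eq (P := P)
    (fun i => (S.measurable_unif (z (ns (ms i)))).aemeasurable)
    (S.measurable_unif Z).aemeasurable (fun i => S.map_unif _) (S.map_unif Z) hunif hq
  have hdm : ∀ Z, AEStronglyMeasurable (fun ω => deriv Q (S.unif Z ω)) P := fun Z =>
    ((measurable_deriv Q).comp (S.measurable_unif Z)).aestronglyMeasurable
  obtain ⟨ks, hks, hkae⟩ := (tendstoInMeasure_of_tendsto_eLpNorm (p := 2) (by norm_num)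
    (fun i => hdm (z (ns (ms i)))) (hdm Z) hqlim).exists_seq_tendsto_ae
  refine ⟨fun i => ms (ks i), ?_⟩
  refine tendsto_Lp_two_of_dominated (memLp_bound (K : ℝ) (W : Lp ℝ 2 P))
    (fun i => S.coeFn_sensitivityLp hQ _ W) (S.coeFn_sensitivityLp hQ Z W)
    (fun i => Eventually.of_forall fun ω => S.abs_sensitivity_le hQ _ W ω) ?_
  have hae' : ∀ᵐ ω ∂P, Tendsto (fun i => ((z (ns (ms (ks i))) : S.L2G) : Lp ℝ 2 P) ω) atTop
      (𝓝 ((Z : Lp ℝ 2 P) ω)) := by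
    filter_upwards [hae] with ω h using h.comp hks.tendsto_atTop
  filter_upwards [hkae, hshift] with ω h1 h2
  have h3 := h2.comp hks.tendsto_atTop
  have hm : ∀ i, AEStronglyMeasurable (((z (ns (ms (ks i))) : S.L2G) : Lp ℝ 2 P) : Ω → ℝ) P :=
    fun i => Lp.aestronglyMeasurable _
  exact h1.mul (((tendsto_smoothing hm (integrable_const (1 : ℝ)) hae' h3).const_mul _).sub
    (tendsto_smoothing hm hWi hae' h3))

/-- Joint continuity follows because the Lipschitz constant in `W` does not depend on `Z`. -/
lemma continuous_sensitivityLp (hQ : IsLipschitzQuantile ν Q K M) :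
    Continuous fun q : S.L2G × S.L2G => S.sensitivityLp hQ q.1 q.2 :=
  continuous_prod_of_continuous_lipschitzWith' _ (2 * K) (S.lipschitzWith_sensitivityLp hQ)
    (S.continuous_sensitivityLp_left hQ)

lemma hasDerivWithinAt_optimizer (hQ : IsLipschitzQuantile ν Q K M) {γ : ℝ → S.L2G} {W : S.L2G}
    {s : Set ℝ} {t : ℝ} (hγ : HasDerivWithinAt γ W s t) :
    HasDerivWithinAt (fun r => S.optimizer hQ (γ r)) (S.sensitivityLp hQ (γ t) W) s t :=
  hasDerivWithinAt_comp_of_lipschitzWith (S.lipschitzWith_optimizer hQ) hγ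
    (S.hasDerivAt_optimizer_line hQ (γ t) W)

/-! ### The derivative of the gradient, expressed through a Brenier potential. -/

/-- The derivative of the gradient of `V` at `Z` in direction `W`. -/
noncomputable def hessV (hQ : IsLipschitzQuantile ν Q K M) (Z W : S.L2G) : S.L2G :=
  condExpL2 ℝ ℝ S.G_le (S.sensitivityLp hQ Z W)

lemma continuous_hessV (hQ : IsLipschitzQuantile ν Q K M) :
    Continuous fun q : S.L2G × S.L2G => S.hessV hQ q.1 q.2 :=
  (condExpL2 ℝ ℝ S.G_le).continuous.comp (S.continuous_sensitivityLp hQ)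

lemma continuousOn_hessV (hQ : IsLipschitzQuantile ν Q K M)
    {Z W : ℝ → S.L2G} {s : Set ℝ} (hZ : ContinuousOn Z s) (hW : ContinuousOn W s) :
    ContinuousOn (fun t => S.hessV hQ (Z t) (W t)) s :=
  (S.continuous_hessV hQ).comp_continuousOn (f := fun t => (Z t, W t)) (hZ.prodMk hW)

lemma hasDerivWithinAt_gradV (hQ : IsLipschitzQuantile ν Q K M)
    (hμ : MemLp (fun x : ℝ => x) 2 μ) {γ : ℝ → S.L2G} {W : S.L2G}
    {s : Set ℝ} {t : ℝ} (hγ : HasDerivWithinAt γ W s t) :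
    HasDerivWithinAt (fun r => S.gradV hQ hμ (γ r))
      (S.hessV hQ (γ t) W) s t :=
  (condExpL2 ℝ ℝ S.G_le).hasFDerivAt.comp_hasDerivWithinAt t
    ((S.hasDerivWithinAt_optimizer hQ hγ).sub_const _)

/-- The directional derivative of the optimizer in terms of a Brenier potential. -/
lemma sensitivity_ae_eq [IsProbabilityMeasure ν] (hQ : IsLipschitzQuantile ν Q K M) {Z : S.L2G}
    {v : ℝ → ℝ} (hv : IsBrenierPotential v (P.map (S.shift Z)) ν) (W : S.L2G) :
    S.sensitivity Q Z W =ᵐ[P] fun ω => S.hess v Z ω * S.resid Z W ω := by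
  have hd : deriv v = S.brenierMap Q Z :=
    funext fun x => (S.hasDerivAt_of_isBrenierPotential hQ hv x).deriv
  filter_upwards [S.ae_differentiableAt_unif hQ Z, S.condShift_ae_eq Z W] with ω h1 h2
  have h3 := h1.hasDerivAt.comp (S.shift Z ω)
    (hasDerivAt_shiftCDF (integrable_coe (Z : Lp ℝ 2 P)) (S.shift Z ω))
  -- Chain rule for `deriv v = Q ∘ F_Z`. Factoring out the positive density `p` then turns `W p - r`
  -- into `p (W - r / p)`.
  have h4 : S.hess v Z ω = deriv Q (S.unif Z ω) *
      smoothing P (Z : Lp ℝ 2 P) (fun _ => 1) (S.shift Z ω) := by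
    rw [hess, hd]; exact h3.deriv
  have hp := smoothing_one_pos ((S.measurable_coe Z).aestronglyMeasurable (μ := P)) (S.shift Z ω)
  rw [sensitivity, h4, resid, h2]
  field_simp

lemma hessV_ae_eq [IsProbabilityMeasure ν] (hQ : IsLipschitzQuantile ν Q K M) {Z : S.L2G}
    {v : ℝ → ℝ} (hv : IsBrenierPotential v (P.map (S.shift Z)) ν) (W : S.L2G) :
    ((S.hessV hQ Z W : Lp ℝ 2 P) : Ω → ℝ) =ᵐ[P]
      P[fun ω => S.hess v Z ω * S.resid Z W ω | S.G] := by
  have h := (S.memLp_sensitivity hQ Z W).condExpL2_ae_eq_condExp (𝕜 := ℝ) S.G_le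
  exact h.trans (condExp_congr_ae (S.sensitivity_ae_eq hQ hv W))

lemma abs_hess_le [IsProbabilityMeasure ν] (hQ : IsLipschitzQuantile ν Q K M) {Z : S.L2G}
    {v : ℝ → ℝ} (hv : IsBrenierPotential v (P.map (S.shift Z)) ν) (ω : Ω) :
    |S.hess v Z ω| ≤ K := by
  have hd : deriv v = S.brenierMap Q Z :=
    funext fun x => (S.hasDerivAt_of_isBrenierPotential hQ hv x).deriv
  rw [hess, hd]
  refine norm_deriv_le_of_lipschitz (f := S.brenierMap Q Z) (LipschitzWith.of_dist_le_mul fun x y => ?_)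
  refine (hQ.lipschitz.dist_le_mul _ _).trans (mul_le_mul_of_nonneg_left ?_ K.2)
  have hi := integrable_coe (Z : Lp ℝ 2 P)
  simpa [Real.dist_eq] using abs_shiftCDF_sub_le hi hi x y

lemma memLp_hess_mul [IsProbabilityMeasure ν] (hQ : IsLipschitzQuantile ν Q K M) {Z : S.L2G}
    {v : ℝ → ℝ} (hv : IsBrenierPotential v (P.map (S.shift Z)) ν) {f : Ω → ℝ} (hf : MemLp f 2 P) :
    MemLp (fun ω => S.hess v Z ω * f ω) 2 P := by
  have hm : Measurable (S.hess v Z) := (measurable_deriv _).comp (S.measurable_shift Z)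
  refine (hf.const_mul (K : ℝ)).mono (hm.aestronglyMeasurable.mul hf.1)
    (Eventually.of_forall fun ω => ?_)
  rw [norm_mul, norm_mul]
  refine mul_le_mul_of_nonneg_right ?_ (norm_nonneg _)
  exact (S.abs_hess_le hQ hv ω).trans (le_abs_self _)

omit [IsProbabilityMeasure P] in
lemma memLp_condShift (Z W : S.L2G) : MemLp (S.condShift Z W) 2 P :=
  (Lp.memLp (W : Lp ℝ 2 P)).condExp (by norm_num)

omit [IsProbabilityMeasure P] in
lemma memLp_resid (Z W : S.L2G) : MemLp (S.resid Z W) 2 P :=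
  (Lp.memLp (W : Lp ℝ 2 P)).sub (S.memLp_condShift Z W)

lemma integrable_hess_mul_resid [IsProbabilityMeasure ν] (hQ : IsLipschitzQuantile ν Q K M)
    {Z : S.L2G} {v : ℝ → ℝ} (hv : IsBrenierPotential v (P.map (S.shift Z)) ν) (W : S.L2G) :
    Integrable (fun ω => S.hess v Z ω * S.resid Z W ω) P :=
  (S.memLp_hess_mul hQ hv (S.memLp_resid Z W)).integrable (by norm_num)

lemma integrable_hess_mul_resid_sq [IsProbabilityMeasure ν] (hQ : IsLipschitzQuantile ν Q K M)
    {Z : S.L2G} {v : ℝ → ℝ} (hv : IsBrenierPotential v (P.map (S.shift Z)) ν) (W : S.L2G) :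
    Integrable (fun ω => S.hess v Z ω * S.resid Z W ω ^ 2) P := by
  refine ((S.memLp_hess_mul hQ hv (S.memLp_resid Z W)).integrable_mul (S.memLp_resid Z W)).congr
    (Eventually.of_forall fun ω => ?_)
  simp only [Pi.mul_apply]
  ring

/-- The second derivative of `V` in direction `W`, as an expectation. -/
lemma inner_sensitivityLp [IsProbabilityMeasure ν] (hQ : IsLipschitzQuantile ν Q K M) {Z : S.L2G}
    {v : ℝ → ℝ} (hv : IsBrenierPotential v (P.map (S.shift Z)) ν) (W : S.L2G) :
    inner ℝ (S.sensitivityLp hQ Z W) (W : Lp ℝ 2 P) =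
      ∫ ω, S.hess v Z ω * S.resid Z W ω ^ 2 ∂P := by
  have hle : MeasurableSpace.comap (S.shift Z) inferInstance ≤ (inferInstance : MeasurableSpace Ω) :=
    (S.measurable_shift Z).comap_le
  have hc := S.memLp_condShift Z W
  have hr := S.memLp_resid Z W
  have hW := Lp.memLp (W : Lp ℝ 2 P)
  have hk := S.memLp_hess_mul hQ hv hc
  have hkm : StronglyMeasurable[MeasurableSpace.comap (S.shift Z) inferInstance]
      (fun ω => S.hess v Z ω * S.condShift Z W ω) :=
    ((measurable_deriv (deriv v)).comp (comap_measurable (S.shift Z))).stronglyMeasurable.mul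
      stronglyMeasurable_condExp
  have hpull : ∫ ω, (S.hess v Z ω * S.condShift Z W ω) * (W : Lp ℝ 2 P) ω ∂P =
      ∫ ω, (S.hess v Z ω * S.condShift Z W ω) * S.condShift Z W ω ∂P := by
    have h1 := condExp_mul_of_stronglyMeasurable_left hkm (hk.integrable_mul hW)
      (integrable_coe (W : Lp ℝ 2 P))
    have h2 := integral_condExp hle
      (f := (fun ω => S.hess v Z ω * S.condShift Z W ω) * ((W : Lp ℝ 2 P) : Ω → ℝ)) (μ := P)
    exact h2.symm.trans (integral_congr_ae h1)
  -- The residual is orthogonal to functions of `Z + Γ`, so one factor `W` in the pairing may be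
  -- replaced by the residual, which produces the square.
  have hzero : ∫ ω, (S.hess v Z ω * S.condShift Z W ω) * S.resid Z W ω ∂P = 0 := by
    have h3 := integral_sub (hk.integrable_mul hW) (hk.integrable_mul hc)
    simp only [Pi.mul_apply] at h3
    rw [hpull, sub_self] at h3
    rw [← h3]
    refine integral_congr_ae (Eventually.of_forall fun ω => ?_)
    simp only [resid]
    ring
  have h4 := integral_add (S.integrable_hess_mul_resid_sq hQ hv W) (hk.integrable_mul hr)
  simp only [Pi.mul_apply] at h4
  rw [hzero, add_zero] at h4
  rw [← h4, L2.inner_def]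
  refine integral_congr_ae ?_
  filter_upwards [S.coeFn_sensitivityLp hQ Z W, S.sensitivity_ae_eq hQ hv W] with ω h1 h2
  rw [h1, h2]
  simp only [RCLike.inner_apply, conj_trivial, resid]
  ring

/-! ### `V` along a line. -/

section Line

variable [IsProbabilityMeasure ν] (hQ : IsLipschitzQuantile ν Q K M)
  (hμ : MemLp (fun x : ℝ => x) 2 μ) (Z W : S.L2G)

omit [IsProbabilityMeasure P] in
lemma hasDerivAt_line (t : ℝ) : HasDerivAt (fun s : ℝ => Z + s • W) W t := by
  simpa using ((hasDerivAt_id t).smul_const W).const_add Z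

include hQ hμ in
lemma hasDerivAt_V_line (t : ℝ) : HasDerivAt (fun s : ℝ => S.V ν (Z + s • W))
    (inner ℝ (S.gradV hQ hμ (Z + t • W)) W) t := by
  have h := (S.hasGradientAt_V hQ hμ (Z + t • W)).hasFDerivAt.comp_hasDerivAt t
    (S.hasDerivAt_line Z W t)
  rw [InnerProductSpace.toDual_apply_apply] at h
  exact h

omit [IsProbabilityMeasure ν] in
lemma hasDerivAt_inner_gradV_line (t : ℝ) :
    HasDerivAt (fun s : ℝ => inner ℝ (S.gradV hQ hμ (Z + s • W)) W)
      (inner ℝ (S.sensitivityLp hQ (Z + t • W) W) (W : Lp ℝ 2 P)) t := by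
  have h1 : HasDerivAt (fun s : ℝ => S.gradV hQ hμ (Z + s • W)) _ t :=
    hasDerivWithinAt_univ.1
      (S.hasDerivWithinAt_gradV hQ hμ (S.hasDerivAt_line Z W t).hasDerivWithinAt)
  have h2 := h1.inner ℝ (hasDerivAt_const t W)
  rw [inner_zero_right, zero_add, hessV, S.inner_condExpL2] at h2
  exact h2

lemma deriv_V_line : deriv (fun s : ℝ => S.V ν (Z + s • W)) =
    fun t => inner ℝ (S.gradV hQ hμ (Z + t • W)) W :=
  funext fun t => (S.hasDerivAt_V_line hQ hμ Z W t).deriv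

omit [IsProbabilityMeasure ν] in
lemma deriv_inner_gradV_line :
    deriv (fun t : ℝ => inner ℝ (S.gradV hQ hμ (Z + t • W)) W) =
      fun t => inner ℝ (S.sensitivityLp hQ (Z + t • W) W) (W : Lp ℝ 2 P) :=
  funext fun t => (S.hasDerivAt_inner_gradV_line hQ hμ Z W t).deriv

include hQ hμ in
lemma contDiff_V_line : ContDiff ℝ 2 (fun s : ℝ => S.V ν (Z + s • W)) := by
  rw [show (2 : WithTop ℕ∞) = 1 + 1 from by norm_num, contDiff_succ_iff_deriv]
  refine ⟨fun t => (S.hasDerivAt_V_line hQ hμ Z W t).differentiableAt, by simp, ?_⟩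
  rw [S.deriv_V_line hQ hμ, contDiff_one_iff_deriv, S.deriv_inner_gradV_line hQ hμ]
  refine ⟨fun t => (S.hasDerivAt_inner_gradV_line hQ hμ Z W t).differentiableAt, ?_⟩
  have hc : Continuous fun t : ℝ => S.sensitivityLp hQ (Z + t • W) W :=
    (S.continuous_sensitivityLp hQ).comp
      (f := fun t : ℝ => (Z + t • W, W)) (by fun_prop)
  exact hc.inner continuous_const

include hμ in
lemma iteratedDerivWithin_V_line {t : ℝ} (ht : t ∈ Icc (0 : ℝ) 1) :
    iteratedDerivWithin 2 (fun s : ℝ => S.V ν (Z + s • W)) (Icc 0 1) t =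
      inner ℝ (S.sensitivityLp hQ (Z + t • W) W) (W : Lp ℝ 2 P) := by
  -- The function is `C²` on all of `ℝ`, so one-sided derivatives at the endpoints of `[0, 1]` agree
  -- with ordinary ones.
  rw [iteratedDerivWithin_eq_iteratedDeriv (uniqueDiffOn_Icc zero_lt_one)
    (S.contDiff_V_line hQ hμ Z W).contDiffAt ht, iteratedDeriv_succ, iteratedDeriv_one,
    S.deriv_V_line hQ hμ, S.deriv_inner_gradV_line hQ hμ]

end Line

end Setting

end Bass

/-! ### The main theorem. -/

theorem mainTheorem7 {Ω : Type*} [MeasurableSpace Ω] (P : Measure Ω) [IsProbabilityMeasure P]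
    (μ ν : Measure ℝ) [IsProbabilityMeasure μ] [IsProbabilityMeasure ν]
    (hμ : MemLp (fun x : ℝ => x) 2 μ) (hν : MemLp (fun x : ℝ => x) 2 ν)
    (hA : Bass.AssumptionA' μ ν) (S : Bass.Setting P μ) :
    -- `D_Z V` exists, and so do the Brenier potential `v` from the law of `Z + Γ` to `ν` and,
    -- for each such potential, `Hv` almost everywhere
    (∀ Z : S.L2G, DifferentiableAt ℝ (S.V ν) Z ∧
      (∃ v : ℝ → ℝ, Bass.IsBrenierPotential v (P.map (S.shift Z)) ν) ∧
      ∀ v : ℝ → ℝ, Bass.IsBrenierPotential v (P.map (S.shift Z)) ν →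
        ∀ᵐ x, DifferentiableAt ℝ v x ∧ DifferentiableAt ℝ (deriv v) x) ∧
    -- the derivative of `t ↦ D_{Z_t} V` along continuously differentiable curves
    (∀ Z G : ℝ → S.L2G,
      (∀ t ∈ Ici (0 : ℝ), HasDerivWithinAt Z (G t) (Ici 0) t) → ContinuousOn G (Ici 0) →
      ∃ D' : ℝ → S.L2G, ContinuousOn D' (Ici 0) ∧
        ∀ t ∈ Ici (0 : ℝ),
          HasDerivWithinAt (fun s => gradient (S.V ν) (Z s)) (D' t) (Ici 0) t ∧
          ∀ v : ℝ → ℝ, Bass.IsBrenierPotential v (P.map (S.shift (Z t))) ν →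
            Integrable (fun ω => S.hess v (Z t) ω * S.resid (Z t) (G t) ω) P ∧
            ((D' t : Lp ℝ 2 P) : Ω → ℝ) =ᵐ[P]
              P[fun ω => S.hess v (Z t) ω * S.resid (Z t) (G t) ω | S.G]) ∧
    -- the second derivative of `V` along lines
    (∀ Z₀ Z₁ : S.L2G,
      ContDiffOn ℝ 2 (fun t : ℝ => S.V ν (Z₀ + t • (Z₁ - Z₀))) (Icc 0 1) ∧
      ∀ t ∈ Icc (0 : ℝ) 1, ∀ v : ℝ → ℝ,
        Bass.IsBrenierPotential v (P.map (S.shift (Z₀ + t • (Z₁ - Z₀)))) ν →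
        Integrable (fun ω => S.hess v (Z₀ + t • (Z₁ - Z₀)) ω *
          S.resid (Z₀ + t • (Z₁ - Z₀)) (Z₁ - Z₀) ω ^ 2) P ∧
        iteratedDerivWithin 2 (fun s : ℝ => S.V ν (Z₀ + s • (Z₁ - Z₀))) (Icc 0 1) t =
          ∫ ω, S.hess v (Z₀ + t • (Z₁ - Z₀)) ω *
            S.resid (Z₀ + t • (Z₁ - Z₀)) (Z₁ - Z₀) ω ^ 2 ∂P) := by
  obtain ⟨Q, K, M, hQ⟩ := hA.exists_lipschitzQuantile
  have hgrad : gradient (S.V ν) = S.gradV hQ hμ :=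
    funext fun Z => (S.hasGradientAt_V hQ hμ Z).gradient
  refine ⟨fun Z => ⟨(S.hasGradientAt_V hQ hμ Z).differentiableAt, S.exists_isBrenierPotential hQ Z,
    fun v hv => ?_⟩, fun Z G hZ hG => ?_, fun Z₀ Z₁ => ⟨?_, fun t ht v hv => ?_⟩⟩
  · have hd := S.hasDerivAt_of_isBrenierPotential hQ hv
    have hd' : deriv v = S.brenierMap Q Z := funext fun x => (hd x).deriv
    rw [hd']
    filter_upwards [(S.monotone_brenierMap hQ Z).ae_differentiableAt] with x hx
      using ⟨(hd x).differentiableAt, hx⟩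
  · refine ⟨fun t => S.hessV hQ (Z t) (G t), ?_, fun t ht => ⟨?_,
      fun v hv => ⟨?_, ?_⟩⟩⟩
    · have hZc : ContinuousOn Z (Ici 0) := fun t ht => (hZ t ht).continuousWithinAt
      exact S.continuousOn_hessV hQ hZc hG
    · rw [hgrad]
      exact S.hasDerivWithinAt_gradV hQ hμ (hZ t ht)
    · exact S.integrable_hess_mul_resid hQ hv (G t)
    · exact S.hessV_ae_eq hQ hv (G t)
  · exact (S.contDiff_V_line hQ hμ Z₀ (Z₁ - Z₀)).contDiffOn
  · exact ⟨S.integrable_hess_mul_resid_sq hQ hv (Z₁ - Z₀),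
      (S.iteratedDerivWithin_V_line hQ hμ Z₀ (Z₁ - Z₀) ht).trans
        (S.inner_sensitivityLp hQ hv (Z₁ - Z₀))⟩
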